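/- Let $r\ge 0$ and let $f\in\mathbb{C}[z_1^{\pm1},\dots,z_r^{\pm1}]$ be a nonzero Laurent polynomial. Let $\mathrm{Log}:(\mathbb{C}^*)^r\to\mathbb{R}^r$, $\mathrm{Log}(z)=(\log|z_1|,\dots,\log|z_r|)$, and let $\mathcal{A}_f=\mathrm{Log}(\{z : f(z)=0\})$ be the amoeba of $f$. *Lopsidedness.* For a Laurent polynomial $g=\sum_j b_j z^j$ let $\mathcal{LA}_g$ be the set of $a\in\mathbb{R}^r$ such that no member of the list $\{|b_j|e^{\langle j,a\rangle} : b_j\ne0\}$ is greater than the sum of all the others. *Cyclic resultants.* For an integer $n\ge1$ let $$f_n(z)=\prod_{k_1=0}^{n-1}\cdots\prod_{k_r=0}^{n-1} f(e^{2\pi i k_1/n}z_1,\dots,e^{2\pi i k_r/n}z_r).$$ *Index.* For a connected component $E$ of $\mathbb{R}^r\setminus\mathcal{A}_f$, its index $\mathrm{ind}(E)\in\mathbb{Z}^r$ is the vector whose $i$-th entry is the number of roots (with multiplicity) of the one-variable Laurent polynomial $p_i(z)=f(\zeta_1,\dots,\zeta_{i-1},z,\zeta_{i+1},\dots,\zeta_r)$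 in $\{0<|z|<|\zeta_i|\}$ plus the smallest exponent that appears in $p_i$; here $\zeta$ is any point with $\mathrm{Log}(\zeta)\in E$, and the result does not depend on $\zeta$. *Approximate spine.* For $k\in\mathbb{Z}^r$ let $M_k(z)$ be the term (possibly zero) of $f_n$ with exponent vector $n^rk$. Let $$M^\infty(x)=\max_{E}\log|M_{\mathrm{ind}(E)}(z)|,\qquad \mathrm{Log}(z)=x,$$ where $E$ runs over the finitely many components of $\mathbb{R}^r\setminus\mathcal{A}_f$ and $\log 0=-\infty$. The approximate spine $\mathcal{LS}_{f,n}$ is the set of points of $\mathbb{R}^r$ at which $M^\infty$ is not smooth. *Spine.* Let $N_f(x)=\frac{1}{(2\pi i)^r}\int_{\mathrm{Log}^{-1}(x)}\log|f(z)|\,\frac{dz_1\cdots dz_r}{z_1\cdots z_r}$ be the Ronkin function. On each component $E$ of $\mathbb{R}^r\setminus\mathcal{A}_f$ it agrees with a unique affine-linear function $N_E$ on $\mathbb{R}^r$. The Passare–Rullgård spine $\mathcal{S}_f$ is the set of points at which $N_f^\infty=\max_E N_E$ is not differentiable. Then: 1. $\mathcal{LS}_{f,n}\subset\mathcal{LA}_{f_n}$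 for every $n\ge1$; 2. $\lim_{n\to\infty}\mathcal{LS}_{f,n}=\mathcal{S}_f$ in the Hausdorff distance of $\mathbb{R}^r$: for every $\varepsilon>0$ there is $N$ such that for all $n\ge N$ every point of $\mathcal{LS}_{f,n}$ is within $\varepsilon$ of $\mathcal{S}_f$ and every point of $\mathcal{S}_f$ is within $\varepsilon$ of $\mathcal{LS}_{f,n}$. -/

import Mathlib

noncomputable section

namespace Amoeba

/-- Laurent polynomials in `r` variables over `ℂ`; the exponent vectors are `Fin r → ℤ`. -/
abbrev Laurent (r : ℕ) : Type := AddMonoidAlgebra ℂ (Fin r → ℤ)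

/-- The complex torus `(ℂ^*)^r`. -/
abbrev Torus (r : ℕ) : Type := Fin r → ℂˣ

/-- The ambient space `ℝ^r` of the amoeba. -/
abbrev Space (r : ℕ) : Type := EuclideanSpace ℝ (Fin r)

variable {r : ℕ}

/-- The map `Log (z_1, …, z_r) = (log |z_1|, …, log |z_r|)`. -/
def Log (z : Torus r) : Space r := WithLp.toLp 2 fun i => Real.log ‖(z i : ℂ)‖

/-- The monomial function `c z_1 ^ j_1 ⋯ z_r ^ j_r`. -/
def monomialEval (j : Fin r → ℤ) (c : ℂ) (z : Torus r) : ℂ := c * ∏ i, (z i : ℂ) ^ j i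

/-- The value `f(z)` of a Laurent polynomial. -/
def eval (f : Laurent r) (z : Torus r) : ℂ := f.coeff.sum fun j c => monomialEval j c z

/-- The amoeba of the hypersurface `f = 0`. -/
def amoeba (f : Laurent r) : Set (Space r) := Log '' {z | eval f z = 0}

/-- The absolute value, at the points of `Log⁻¹(a)`, of the term of `f` with exponent vector `j`. -/
def termAbs (f : Laurent r) (j : Fin r → ℤ) (a : Space r) : ℝ :=
  ‖f.coeff j‖ * Real.exp (∑ i, (j i : ℝ) * a i)

theorem norm_monomialEval (f : Laurent r) (j : Fin r → ℤ) (z : Torus r) :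
    ‖monomialEval j (f.coeff j) z‖ = termAbs f j (Log z) := by
  simp only [monomialEval, termAbs, Log, norm_mul, norm_prod, norm_zpow, Real.exp_sum]
  congr 1
  refine Finset.prod_congr rfl fun i _ => ?_
  have h : 0 < ‖(z i : ℂ)‖ := norm_pos_iff.2 (z i).ne_zero
  rw [mul_comm, Real.exp_mul, Real.exp_log h, Real.rpow_intCast]

/-- The finite list `(b i)`, `i ∈ s`, is lopsided: one member exceeds the sum of all the others. -/
def Lopsided {ι : Type*} [DecidableEq ι] (s : Finset ι) (b : ι → ℝ) : Prop :=
  ∃ i ∈ s, ∑ j ∈ s.erase i, b j < b i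

/-- The set `LA_f` of the points `a` at which the list of the absolute values of the terms of `f`
is not lopsided. -/
def lopsidedAmoeba (f : Laurent r) : Set (Space r) :=
  {a | ¬ Lopsided f.coeff.support fun j => termAbs f j a}

/-- The Laurent polynomial `f(u_1 z_1, …, u_r z_r)`. -/
def rescale (u : Torus r) (f : Laurent r) : Laurent r :=
  f.coeff.sum fun j c => AddMonoidAlgebra.single j (monomialEval j c u)

/-- The point `(e^{2πi k_1/n}, …, e^{2πi k_r/n})` of the torus. -/
def rootPoint (n : ℕ) (k : Fin r → Fin n) : Torus r := fun i =>
  Units.mk0 (Complex.exp (2 * Real.pi * Complex.I * ((k i : ℕ) : ℂ) / (n : ℂ)))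
    (Complex.exp_ne_zero _)

/-- The cyclic resultant
`f_n(z) = ∏_{k_1 = 0}^{n - 1} ⋯ ∏_{k_r = 0}^{n - 1} f(e^{2πi k_1/n} z_1, …, e^{2πi k_r/n} z_r)`. -/
def cyclicResultant (n : ℕ) (f : Laurent r) : Laurent r :=
  ∏ k : Fin r → Fin n, rescale (rootPoint n k) f

/-- The connected components of the complement of the amoeba. -/
def complementComponents (f : Laurent r) : Set (Set (Space r)) :=
  {E | ∃ a ∈ (amoeba f)ᶜ, E = connectedComponentIn (amoeba f)ᶜ a}

/-! ### The index of a component -/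

/-- The one-variable Laurent polynomial `f(ζ_1, …, ζ_{i-1}, z, ζ_{i+1}, …, ζ_r)`. -/
def restrict (f : Laurent r) (ζ : Torus r) (i : Fin r) : LaurentPolynomial ℂ :=
  f.coeff.sum fun j c =>
    AddMonoidAlgebra.single (j i) (c * ∏ l ∈ Finset.univ.erase i, (ζ l : ℂ) ^ j l)

/-- The smallest exponent that appears in a (nonzero) one-variable Laurent polynomial. -/
def mindeg (p : LaurentPolynomial ℂ) : ℤ := sInf (p.coeff.support : Set ℤ)

/-- The number of roots `z` of `p`, with multiplicity, such that `0 < |z| < R`. The polynomial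
`z ^ (-mindeg p) * p` has the same nonzero roots as `p`. -/
def rootCount (p : LaurentPolynomial ℂ) (R : ℝ) : ℕ :=
  Multiset.countP (fun z : ℂ => 0 < ‖z‖ ∧ ‖z‖ < R)
    (LaurentPolynomial.trunc (LaurentPolynomial.T (-mindeg p) * p)).roots

/-- The index vector, computed from a point `ζ` of the torus with `Log ζ` outside the amoeba:
its `i`-th entry is the number of roots of `f(ζ_1, …, z, …, ζ_r)` in `0 < |z| < |ζ_i|`, plus the
smallest exponent of this Laurent polynomial (that is, roots minus poles in `|z| < |ζ_i|`). -/
def index (f : Laurent r) (ζ : Torus r) : Fin r → ℤ := fun i =>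
  (rootCount (restrict f ζ i) ‖(ζ i : ℂ)‖ : ℤ) + mindeg (restrict f ζ i)

/-- The point `(e^{a_1}, …, e^{a_r})`. -/
def expPoint (a : Space r) : Torus r := fun i =>
  Units.mk0 (Complex.exp (a i : ℂ)) (Complex.exp_ne_zero _)

theorem Log_expPoint (a : Space r) : Log (expPoint a) = a := by
  ext i
  simp [Log, expPoint, Complex.norm_exp]

/-- The index of a component `E` of the complement of the amoeba. It is computed at some point of
`Log⁻¹(E)`; the index vector is the same at all of them. -/
def componentIndex (f : Laurent r) (E : complementComponents f) : Fin r → ℤ :=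
  index f (expPoint E.2.choose)

/-! ### The Ronkin function and the spine -/

/-- The Ronkin function: the mean value of `log |f|` over the torus `Log⁻¹(x)`, that is
`(2πi)^{-r} ∫_{Log⁻¹(x)} log |f(z)| dz_1 ⋯ dz_r / (z_1 ⋯ z_r)` with `z_i = e^{x_i + iθ_i}`. -/
def ronkin (f : Laurent r) (x : Space r) : ℝ :=
  ((2 * Real.pi) ^ r)⁻¹ *
    ∫ θ in Set.Icc (0 : Fin r → ℝ) (fun _ => 2 * Real.pi),
      Real.log ‖eval f fun i =>
        Units.mk0 (Complex.exp ((x i : ℂ) + (θ i : ℂ) * Complex.I)) (Complex.exp_ne_zero _)‖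

open Classical in
/-- The affine-linear function `N_E` on `ℝ^r` that extends the restriction of the Ronkin function
to the component `E`. -/
def affineExtension (f : Laurent r) (E : complementComponents f) : Space r →ᵃ[ℝ] ℝ :=
  if h : ∃ A : Space r →ᵃ[ℝ] ℝ, Set.EqOn A (ronkin f) E.1 then h.choose else 0

/-- The function `N_f^∞ = max_E N_E`, the maximum over the (finitely many) components. -/
def ronkinMax (f : Laurent r) (x : Space r) : ℝ :=
  ⨆ E : complementComponents f, affineExtension f E x

/-- The Passare–Rullgård spine: the set of points where `N_f^∞` is not differentiable. -/
def spine (f : Laurent r) : Set (Space r) := {x | ¬ DifferentiableAt ℝ (ronkinMax f) x}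

/-! ### The approximate spine -/

/-- The exponent vector `n^r k` of the candidate dominant term `M_k` of `f_n`, where `k` is the
index of the component `E`. -/
def dominantExponent (f : Laurent r) (n : ℕ) (E : complementComponents f) : Fin r → ℤ :=
  n ^ r • componentIndex f E

/-- The function `M^∞(x) = max log |M_k(z)|`, `Log z = x`: the maximum over the components of the
complement of the amoeba of `f`, where `k` is the index of the component and `M_k` is the term of
`f_n` with exponent vector `n^r k`. A component for which this term is zero contributes
`log 0 = -∞` to the maximum, and is therefore left out. -/
def approxMax (f : Laurent r) (n : ℕ) (x : Space r) : ℝ :=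
  ⨆ E : {E : complementComponents f //
      (cyclicResultant n f).coeff (dominantExponent f n E) ≠ 0},
    Real.log (termAbs (cyclicResultant n f) (dominantExponent f n E.1) x)

/-- The approximate spine `LS_{f,n}`: the set of points where `M^∞` is not smooth. -/
def approxSpine (f : Laurent r) (n : ℕ) : Set (Space r) :=
  {x | ¬ ContDiffAt ℝ ((⊤ : ℕ∞) : WithTop ℕ∞) (approxMax f n) x}

end Amoeba

end

noncomputable section

namespace Amoeba

variable {r : ℕ}

/-! Fix `x` outside the amoeba. In one coordinate `f` is `c z^m ∏ (z - ρ)`, and multiplying over the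
rotations of `z` by `n`-th roots of unity turns each `z - ρ` into `±(ρ^n - z^n)`. No root has
modulus near `|z|`, so up to a factor `exp(O(q^n))` with `q < 1` an inner root contributes a
constant times `z^n` and an outer one a constant. The product is thus nearly a monomial whose degree
is `n` times the index (`exists_prod_shift_eq`). Treating the coordinates in turn, `f_n` on the
fibre over `x` is a monomial of exponent `n^r ind(E)` up to `exp(O(n^r q^n))`
(`exists_cyclicResultant_polar`).

This has three uses. The index is the slope of the logarithm of a product of values of `f`, up to a
small error; being an integer, it is locally constant in continuous families
(`eventually_index_eq`). Averaging `f_n` against a character isolates the coefficient at `n^r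
ind(E)`, and the mean of `log |f_n|` over the fibre is `n^r N_f(x)`, so the logarithm of that term
is `n^r N_f(x) + o(1)` (`eventually_log_termAbs`). Comparing two points of equal index, `N_f` is
affine of slope `ind(E)` on `E`, and components of equal index have the same `N_E`. Both maxima
therefore run over the finite set of index vectors, and injectivity of the index is not needed.

Inclusion: where `f_n` is lopsided, deforming it to its dominant term shows that the dominant
exponent is the index of `f_n`, namely `n^r ind(E)`. One candidate then strictly beats the others
and the maximum is locally affine.

Convergence: `M^∞` and `n^r N_f^∞` are maxima of affine functions with the same slopes `n^r v` and
constants differing by `o(1)`. Distinct slopes are at distance at least 1, so the corner loci are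
close (`exists_not_differentiableAt`). -/

/-- Evaluation at a point of the torus, as an algebra homomorphism. -/
def evalHom (z : Torus r) : Laurent r →ₐ[ℂ] ℂ :=
  AddMonoidAlgebra.lift ℂ ℂ (Fin r → ℤ)
    { toFun := fun j => ∏ i, (z i : ℂ) ^ (j.toAdd i)
      map_one' := by simp
      map_mul' := fun a b => by
        simp [zpow_add₀ (z _).ne_zero, Finset.prod_mul_distrib] }

theorem evalHom_apply (z : Torus r) (f : Laurent r) : evalHom z f = eval f z := by
  simp [evalHom, AddMonoidAlgebra.lift_apply, eval, monomialEval]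

theorem eval_single (j : Fin r → ℤ) (c : ℂ) (z : Torus r) :
    eval (AddMonoidAlgebra.single j c) z = monomialEval j c z := by
  simp [eval, monomialEval]

theorem eval_rescale (u : Torus r) (f : Laurent r) (z : Torus r) :
    eval (rescale u f) z = eval f (u * z) := by
  rw [← evalHom_apply, rescale, Finsupp.sum, map_sum, eval, Finsupp.sum]
  refine Finset.sum_congr rfl fun j _ => ?_
  rw [evalHom_apply, eval_single]
  simp only [monomialEval, Pi.mul_apply, Units.val_mul, mul_zpow, Finset.prod_mul_distrib]
  ring

theorem eval_cyclicResultant (n : ℕ) (f : Laurent r) (z : Torus r) :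
    eval (cyclicResultant n f) z = ∏ k : Fin r → Fin n, eval f (rootPoint n k * z) := by
  rw [← evalHom_apply, cyclicResultant, map_prod]
  simp_rw [evalHom_apply, eval_rescale]

/-! ### Restriction to one variable: factorization and bounds on the index -/

theorem eval_restrict (f : Laurent r) (ζ : Torus r) (i : Fin r) (z : ℂˣ) :
    LaurentPolynomial.eval₂ (RingHom.id ℂ) z (restrict f ζ i) =
      eval f (Function.update ζ i z) := by
  rw [restrict, Finsupp.sum, map_sum, eval, Finsupp.sum]
  refine Finset.sum_congr rfl fun j _ => ?_
  rw [LaurentPolynomial.single_eq_C_mul_T, LaurentPolynomial.eval₂_C_mul_T, monomialEval,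
    ← Finset.mul_prod_erase _ _ (Finset.mem_univ i)]
  have : ∏ l ∈ Finset.univ.erase i, ((Function.update ζ i z l : ℂˣ) : ℂ) ^ j l =
      ∏ l ∈ Finset.univ.erase i, (ζ l : ℂ) ^ j l :=
    Finset.prod_congr rfl fun l hl => by rw [Function.update_of_ne (Finset.ne_of_mem_erase hl)]
  rw [this]
  simp
  ring

theorem support_restrict (f : Laurent r) (ζ : Torus r) (i : Fin r) {k : ℤ}
    (hk : k ∈ (restrict f ζ i).coeff.support) : ∃ j ∈ f.coeff.support, j i = k := by
  rw [restrict, Finsupp.sum, AddMonoidAlgebra.coeff_sum] at hk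
  obtain ⟨j, hj, hk⟩ := Finset.mem_biUnion.1 (Finsupp.support_finsetSum hk)
  refine ⟨j, hj, ?_⟩
  rw [AddMonoidAlgebra.coeff_single] at hk
  exact (Finset.mem_singleton.1 (Finsupp.support_single_subset hk)).symm

theorem mindeg_mem_support {p : LaurentPolynomial ℂ} (hp : p ≠ 0) :
    mindeg p ∈ p.coeff.support := by
  have h : (p.coeff.support : Set ℤ).Nonempty := by
    simpa [Finset.nonempty_iff_ne_empty] using hp
  exact_mod_cast Int.csInf_mem h (Finset.bddBelow _)

theorem mindeg_le {p : LaurentPolynomial ℂ} {k : ℤ} (hk : k ∈ p.coeff.support) :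
    mindeg p ≤ k := csInf_le (Finset.bddBelow _) (by exact_mod_cast hk)

theorem coeff_trunc (p : LaurentPolynomial ℂ) (k : ℕ) :
    (LaurentPolynomial.trunc p).coeff k = p.coeff k := rfl

theorem toLaurent_trunc_T_mul (p : LaurentPolynomial ℂ) :
    Polynomial.toLaurent (LaurentPolynomial.trunc (LaurentPolynomial.T (-mindeg p) * p)) =
      LaurentPolynomial.T (-mindeg p) * p := by
  ext a
  rw [LaurentPolynomial.coeff_toLaurent]
  rcases lt_or_ge a 0 with ha | ha
  -- After the shift by `-mindeg p` no negative exponent is left for `trunc` to discard.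
  · rw [Finsupp.mapDomain_of_notMem_range _ _ (by rintro ⟨k, rfl⟩; simp at ha; omega),
      LaurentPolynomial.T, AddMonoidAlgebra.coeff_single_mul_apply, one_mul, eq_comm]
    by_contra h
    have := mindeg_le (Finsupp.mem_support_iff.2 h)
    omega
  · lift a to ℕ using ha
    exact Finsupp.mapDomain_apply Nat.castEmbedding.injective _ a

/-- A nonzero Laurent polynomial in one variable is a constant times a monomial times a product
over its nonzero roots. -/
theorem exists_factorization {p : LaurentPolynomial ℂ} (hp : p ≠ 0) {A B : ℤ}
    (hA : ∀ k ∈ p.coeff.support, A ≤ k) (hB : ∀ k ∈ p.coeff.support, k ≤ B) :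
    ∃ (c : ℂ) (S : Multiset ℂ), c ≠ 0 ∧ (0 : ℂ) ∉ S ∧
      (∀ z : ℂˣ, LaurentPolynomial.eval₂ (RingHom.id ℂ) z p =
        c * (z : ℂ) ^ mindeg p * (S.map fun ρ => (z : ℂ) - ρ).prod) ∧
      (∀ R, rootCount p R = S.countP fun ρ => ‖ρ‖ < R) ∧
      A ≤ mindeg p ∧ mindeg p + S.card ≤ B := by
  set q := LaurentPolynomial.trunc (LaurentPolynomial.T (-mindeg p) * p) with hq
  have hqp := toLaurent_trunc_T_mul p
  rw [← hq] at hqp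
  have hc (k : ℕ) : q.coeff k = p.coeff (k + mindeg p) := by
    rw [hq, coeff_trunc, LaurentPolynomial.T, AddMonoidAlgebra.coeff_single_mul_apply, one_mul,
      neg_neg, add_comm]
  have h0 : q.coeff 0 ≠ 0 := by
    rw [hc]
    simpa using mindeg_mem_support hp
  have hq0 : q ≠ 0 := fun h => h0 (by simp [h])
  have hr : (0 : ℂ) ∉ q.roots := by
    rw [Polynomial.mem_roots hq0, Polynomial.IsRoot, ← Polynomial.coeff_zero_eq_eval_zero]
    exact h0
  have hs : q.Splits := IsAlgClosed.splits q
  refine ⟨q.leadingCoeff, q.roots, by simpa using hq0, hr, fun z => ?_, fun R => ?_,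
    hA _ (mindeg_mem_support hp), ?_⟩
  · have h1 : p = LaurentPolynomial.T (mindeg p) * Polynomial.toLaurent q := by
      rw [hqp, ← mul_assoc, ← LaurentPolynomial.T_add]
      simp
    have h2 : q.eval (z : ℂ) = q.leadingCoeff * (q.roots.map fun ρ => (z : ℂ) - ρ).prod :=
      hs.eval_eq_prod_roots _
    conv_lhs => rw [h1]
    rw [map_mul, LaurentPolynomial.eval₂_T, LaurentPolynomial.eval₂_toLaurent,
      Polynomial.eval₂_id, h2, Units.val_zpow_eq_zpow_val]
    ring
  · rw [rootCount, ← hq]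
    refine Multiset.countP_congr rfl fun ρ hρ => ?_
    have : ρ ≠ 0 := fun h => hr (h ▸ hρ)
    simp [this]
  · have h3 : q.roots.card = q.natDegree := hs.natDegree_eq_card_roots.symm
    rw [h3, add_comm]
    refine hB _ (Finsupp.mem_support_iff.2 ?_)
    rw [← hc]
    simpa using hq0

theorem restrict_ne_zero {f : Laurent r} {ζ : Torus r} (i : Fin r) (h : eval f ζ ≠ 0) :
    restrict f ζ i ≠ 0 := by
  intro h0
  have := eval_restrict f ζ i (ζ i)
  rw [h0, map_zero, Function.update_eq_self] at this
  exact h this.symm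

/-- The index is the lowest degree plus the number of some of the nonzero roots, while adding all of
them gives the highest degree. This later makes the set of indices finite. -/
theorem index_mem_Icc {f : Laurent r} {ζ : Torus r} {i : Fin r} {A B : ℤ}
    (h : eval f ζ ≠ 0) (hA : ∀ j ∈ f.coeff.support, A ≤ j i)
    (hB : ∀ j ∈ f.coeff.support, j i ≤ B) : index f ζ i ∈ Set.Icc A B := by
  obtain ⟨c, S, -, -, -, hS, h1, h2⟩ := exists_factorization (restrict_ne_zero i h)
    (A := A) (B := B)
    (fun k hk => by obtain ⟨j, hj, rfl⟩ := support_restrict f ζ i hk; exact hA j hj)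
    (fun k hk => by obtain ⟨j, hj, rfl⟩ := support_restrict f ζ i hk; exact hB j hj)
  have h3 := S.countP_le_card (fun ρ => ‖ρ‖ < ‖(ζ i : ℂ)‖)
  simp only [index, hS, Set.mem_Icc]
  constructor <;> omega

theorem index_single {j : Fin r → ℤ} {c : ℂ} (hc : c ≠ 0) (ζ : Torus r) :
    index (AddMonoidAlgebra.single j c) ζ = j := by
  funext i
  have h := index_mem_Icc (f := AddMonoidAlgebra.single j c) (ζ := ζ) (i := i) (A := j i)
    (B := j i) (by
      rw [eval_single]
      exact mul_ne_zero hc (Finset.prod_ne_zero_iff.2 fun i _ => zpow_ne_zero _ (ζ i).ne_zero))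
    (fun k hk => by
      rw [AddMonoidAlgebra.coeff_single] at hk
      rw [Finset.mem_singleton.1 (Finsupp.support_single_subset hk)])
    (fun k hk => by
      rw [AddMonoidAlgebra.coeff_single] at hk
      rw [Finset.mem_singleton.1 (Finsupp.support_single_subset hk)])
  exact le_antisymm h.2 h.1

/-! ### Products over roots of unity in one variable -/

/-- Errors are kept as factors `exp l` with `‖l‖` small, so that they add up under products and
their real parts bound the error of `log ‖·‖`. -/
theorem exists_exp_eq_one_sub {u : ℂ} {η : ℝ} (hu : ‖u‖ ≤ η) (hη : η ≤ 1 / 2) :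
    ∃ l : ℂ, 1 - u = Complex.exp l ∧ ‖l‖ ≤ 3 / 2 * η := by
  have h : ‖-u‖ ≤ 1 / 2 := by rw [norm_neg]; linarith
  refine ⟨Complex.log (1 + -u), ?_, ?_⟩
  · rw [Complex.exp_log, sub_eq_add_neg]
    intro h0
    have : u = 1 := by linear_combination -h0
    rw [this, norm_neg, norm_one] at h
    norm_num at h
  · refine (Complex.norm_log_one_add_half_le_self h).trans ?_
    rw [norm_neg]
    linarith

theorem prod_root_sub {n : ℕ} (hn : 0 < n) (z ρ : ℂ) :
    ∏ k : Fin n, (z * Complex.exp (2 * Real.pi * Complex.I * ((k : ℕ) : ℂ) / (n : ℂ)) - ρ) =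
      (-1) ^ n * (ρ ^ n - z ^ n) := by
  have hn' : (n : ℂ) ≠ 0 := by exact_mod_cast hn.ne'
  have hω := Complex.isPrimitiveRoot_exp n hn.ne'
  have hk (k : ℕ) : Complex.exp (2 * Real.pi * Complex.I * (k : ℂ) / (n : ℂ)) =
      Complex.exp (2 * Real.pi * Complex.I / n) ^ k := by
    rw [← Complex.exp_nat_mul]
    congr 1
    ring
  rw [hω.pow_sub_pow_eq_prod_sub_mul ρ z hn]
  have : ∏ ζ ∈ Polynomial.nthRootsFinset n (1 : ℂ), (ρ - ζ * z) =
      ∏ k : Fin n, (ρ - Complex.exp (2 * Real.pi * Complex.I / n) ^ (k : ℕ) * z) := by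
    rw [Fin.prod_univ_eq_prod_range
      (fun k => ρ - Complex.exp (2 * Real.pi * Complex.I / n) ^ k * z) n]
    symm
    refine Finset.prod_bij (fun k _ => Complex.exp (2 * Real.pi * Complex.I / n) ^ k)
      ?_ ?_ ?_ ?_
    · intro k _
      rw [Polynomial.mem_nthRootsFinset hn, pow_right_comm, hω.pow_eq_one, one_pow]
    · intro a ha b hb h
      exact hω.pow_inj (Finset.mem_range.1 ha) (Finset.mem_range.1 hb) h
    · intro ζ hζ
      have : NeZero n := ⟨hn.ne'⟩
      obtain ⟨k, hk, rfl⟩ := hω.eq_pow_of_pow_eq_one ((Polynomial.mem_nthRootsFinset hn _).1 hζ)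
      exact ⟨k, Finset.mem_range.2 hk, rfl⟩
    · intro _ _
      rfl
  rw [this]
  simp_rw [hk]
  have h2 (k : Fin n) : z * Complex.exp (2 * Real.pi * Complex.I / n) ^ (k : ℕ) - ρ =
      (-1) * (ρ - Complex.exp (2 * Real.pi * Complex.I / n) ^ (k : ℕ) * z) := by ring
  simp_rw [h2]
  rw [Finset.prod_mul_distrib]
  simp

/-- For a root well inside both circles, `-b ^ n` dominates `ρ ^ n - b ^ n`, so moving from `a` to
`a * exp s` multiplies it by about `exp (n * s)`. Each endpoint costs `3 / 2 * q ^ n`. -/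
theorem exists_pow_sub_pow_inside {a s ρ : ℂ} {q : ℝ} {n : ℕ} (ha : a ≠ 0)
    (hq : q ^ n ≤ 1 / 2) (h0 : ‖ρ‖ ≤ q * ‖a‖) (h1 : ‖ρ‖ ≤ q * ‖a * Complex.exp s‖) :
    ∃ l : ℂ, ρ ^ n - (a * Complex.exp s) ^ n =
      (ρ ^ n - a ^ n) * Complex.exp (n * s) * Complex.exp l ∧ ‖l‖ ≤ 3 * q ^ n := by
  have key (b : ℂ) (hb : b ≠ 0) (h : ‖ρ‖ ≤ q * ‖b‖) : ∃ l : ℂ,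
      ρ ^ n - b ^ n = -b ^ n * Complex.exp l ∧ ‖l‖ ≤ 3 / 2 * q ^ n := by
    have hb' := norm_pos_iff.2 hb
    obtain ⟨l, hl, hl'⟩ := exists_exp_eq_one_sub (u := (ρ / b) ^ n) (η := q ^ n) (by
      rw [norm_pow, norm_div]
      exact pow_le_pow_left₀ (by positivity) ((div_le_iff₀ hb').2 h) n) hq
    refine ⟨l, ?_, hl'⟩
    rw [← hl, div_pow]
    field_simp
    ring
  obtain ⟨l0, e0, b0⟩ := key a ha h0
  obtain ⟨l1, e1, b1⟩ := key _ (mul_ne_zero ha (Complex.exp_ne_zero s)) h1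
  refine ⟨l1 - l0, ?_, (norm_sub_le _ _).trans (by linarith)⟩
  rw [e0, e1, Complex.exp_sub, mul_pow, ← Complex.exp_nat_mul]
  field_simp [Complex.exp_ne_zero]

/-- For a root well outside both circles the constant `ρ ^ n` dominates, so the move changes almost
nothing. -/
theorem exists_pow_sub_pow_outside {a s ρ : ℂ} {q : ℝ} {n : ℕ} (hρ : ρ ≠ 0)
    (hq : q ^ n ≤ 1 / 2) (h0 : ‖a‖ ≤ q * ‖ρ‖) (h1 : ‖a * Complex.exp s‖ ≤ q * ‖ρ‖) :
    ∃ l : ℂ, ρ ^ n - (a * Complex.exp s) ^ n =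
      (ρ ^ n - a ^ n) * Complex.exp l ∧ ‖l‖ ≤ 3 * q ^ n := by
  have key (b : ℂ) (h : ‖b‖ ≤ q * ‖ρ‖) : ∃ l : ℂ,
      ρ ^ n - b ^ n = ρ ^ n * Complex.exp l ∧ ‖l‖ ≤ 3 / 2 * q ^ n := by
    have hb' := norm_pos_iff.2 hρ
    obtain ⟨l, hl, hl'⟩ := exists_exp_eq_one_sub (u := (b / ρ) ^ n) (η := q ^ n) (by
      rw [norm_pow, norm_div]
      exact pow_le_pow_left₀ (by positivity) ((div_le_iff₀ hb').2 h) n) hq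
    refine ⟨l, ?_, hl'⟩
    rw [← hl, div_pow]
    field_simp
  obtain ⟨l0, e0, b0⟩ := key a h0
  obtain ⟨l1, e1, b1⟩ := key _ h1
  refine ⟨l1 - l0, ?_, (norm_sub_le _ _).trans (by linarith)⟩
  rw [e0, e1, Complex.exp_sub]
  field_simp [Complex.exp_ne_zero]

/-- Only the inner roots contribute a factor `exp (n * s)`, so their number becomes the exponent. -/
theorem exists_multiset_prod_pow_sub_pow {a s : ℂ} {q : ℝ} {n : ℕ} (ha : a ≠ 0)
    (hq1 : q < 1) (hq : q ^ n ≤ 1 / 2) (S : Multiset ℂ)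
    (hS : ∀ ρ ∈ S, ρ ≠ 0 ∧ ((‖ρ‖ ≤ q * ‖a‖ ∧ ‖ρ‖ ≤ q * ‖a * Complex.exp s‖) ∨
      (‖a‖ ≤ q * ‖ρ‖ ∧ ‖a * Complex.exp s‖ ≤ q * ‖ρ‖))) :
    ∃ l : ℂ, (S.map fun ρ => ρ ^ n - (a * Complex.exp s) ^ n).prod =
      (S.map fun ρ => ρ ^ n - a ^ n).prod *
        Complex.exp (n * (S.countP fun ρ => ‖ρ‖ < ‖a‖ : ℕ) * s) * Complex.exp l ∧
      ‖l‖ ≤ 3 * S.card * q ^ n := by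
  induction S using Multiset.induction_on with
  | empty => exact ⟨0, by simp, by simp⟩
  | cons ρ S ih =>
    obtain ⟨l, hl, hl'⟩ := ih fun ρ' h => hS ρ' (Multiset.mem_cons_of_mem h)
    obtain ⟨hρ, h⟩ := hS ρ (Multiset.mem_cons_self ρ S)
    have ha' := norm_pos_iff.2 ha
    have hρ' := norm_pos_iff.2 hρ
    rcases h with ⟨h0, h1⟩ | ⟨h0, h1⟩
    · obtain ⟨l', e, b⟩ := exists_pow_sub_pow_inside ha hq h0 h1
      have hlt : ‖ρ‖ < ‖a‖ := h0.trans_lt (by nlinarith)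
      refine ⟨l + l', ?_, (norm_add_le _ _).trans ?_⟩
      · rw [Multiset.map_cons, Multiset.prod_cons, Multiset.map_cons, Multiset.prod_cons, hl, e,
          Multiset.countP_cons_of_pos (p := fun ρ => ‖ρ‖ < ‖a‖) _ hlt, Complex.exp_add]
        push_cast
        rw [show (n : ℂ) * ((S.countP fun ρ => ‖ρ‖ < ‖a‖ : ℕ) + 1) * s =
          n * (S.countP fun ρ => ‖ρ‖ < ‖a‖ : ℕ) * s + n * s by ring, Complex.exp_add]
        ring
      · rw [Multiset.card_cons]
        push_cast
        linarith
    · obtain ⟨l', e, b⟩ := exists_pow_sub_pow_outside hρ hq h0 h1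
      have hlt : ¬ ‖ρ‖ < ‖a‖ := not_lt.2 (h0.trans (by nlinarith))
      refine ⟨l + l', ?_, (norm_add_le _ _).trans ?_⟩
      · rw [Multiset.map_cons, Multiset.prod_cons, Multiset.map_cons, Multiset.prod_cons, hl, e,
          Multiset.countP_cons_of_neg (p := fun ρ => ‖ρ‖ < ‖a‖) _ hlt, Complex.exp_add]
        ring
      · rw [Multiset.card_cons]
        push_cast
        linarith

/-! ### Logarithmic coordinates and the index as an asymptotic degree -/

/-- The point `(e^{w_1}, …, e^{w_r})` of the torus. -/
def cexpTorus (w : Fin r → ℂ) : Torus r := fun i =>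
  Units.mk0 (Complex.exp (w i)) (Complex.exp_ne_zero _)

theorem cexpTorus_add (w w' : Fin r → ℂ) :
    cexpTorus (w + w') = cexpTorus w * cexpTorus w' := by
  funext i
  ext
  simp [cexpTorus, Complex.exp_add]

theorem cexpTorus_add_single (w : Fin r → ℂ) (i : Fin r) (s : ℂ) :
    cexpTorus (w + Pi.single i s) = Function.update (cexpTorus w) i
      (Units.mk0 (Complex.exp (w i) * Complex.exp s)
        (mul_ne_zero (Complex.exp_ne_zero _) (Complex.exp_ne_zero _))) := by
  funext l
  ext
  rcases eq_or_ne l i with rfl | h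
  · simp [cexpTorus, Complex.exp_add]
  · simp [cexpTorus, h]

/-- The product of the values of `f` over the `n`-th roots of unity in one coordinate behaves like
a monomial, with exponent `n` times the entry of the index. -/
theorem exists_prod_shift_eq {f : Laurent r} {w : Fin r → ℂ} {i : Fin r} {δ : ℝ} (hδ0 : 0 < δ)
    (hδ : ∀ s : ℂ, |s.re| ≤ δ → eval f (cexpTorus (w + Pi.single i s)) ≠ 0) {A B : ℤ}
    (hA : ∀ j ∈ f.coeff.support, A ≤ j i) (hB : ∀ j ∈ f.coeff.support, j i ≤ B)
    {n : ℕ} (hn : 0 < n) (hq : Real.exp (-(δ / 2)) ^ n ≤ 1 / 2) {s : ℂ} (hs : |s.re| ≤ δ / 2) :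
    ∃ l : ℂ, ∏ k : Fin n, eval f (cexpTorus (w + Pi.single i
        (s + 2 * Real.pi * Complex.I * ((k : ℕ) : ℂ) / (n : ℂ)))) =
      (∏ k : Fin n, eval f (cexpTorus (w + Pi.single i
        (2 * Real.pi * Complex.I * ((k : ℕ) : ℂ) / (n : ℂ))))) *
        Complex.exp (n * index f (cexpTorus w) i * s) * Complex.exp l ∧
      ‖l‖ ≤ 3 * (B - A) * Real.exp (-(δ / 2)) ^ n := by
  have hp : restrict f (cexpTorus w) i ≠ 0 :=
    restrict_ne_zero i (by simpa using hδ 0 (by simpa using hδ0.le))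
  obtain ⟨c, S, hc, hS0, hS, hcount, hA', hB'⟩ := exists_factorization hp (A := A) (B := B)
    (fun k hk => by obtain ⟨j, hj, rfl⟩ := support_restrict f _ i hk; exact hA j hj)
    (fun k hk => by obtain ⟨j, hj, rfl⟩ := support_restrict f _ i hk; exact hB j hj)
  set a := Complex.exp (w i) with ha
  set m := mindeg (restrict f (cexpTorus w) i) with hm
  have ha0 : a ≠ 0 := Complex.exp_ne_zero _
  have hev (s : ℂ) : eval f (cexpTorus (w + Pi.single i s)) =
      c * (a * Complex.exp s) ^ m * (S.map fun ρ => a * Complex.exp s - ρ).prod := by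
    rw [cexpTorus_add_single, ← eval_restrict, hS]
    rfl
  set q := Real.exp (-(δ / 2)) with hqdef
  have hq1 : q < 1 := Real.exp_lt_one_iff.2 (by linarith)
  have hqpos : 0 < q := Real.exp_pos _
  have haS : ‖a * Complex.exp s‖ = ‖a‖ * Real.exp s.re := by rw [norm_mul, Complex.norm_exp s]
  have hapos : 0 < ‖a‖ := norm_pos_iff.2 ha0
  have hroot : ∀ ρ ∈ S, ρ ≠ 0 ∧ ((‖ρ‖ ≤ q * ‖a‖ ∧ ‖ρ‖ ≤ q * ‖a * Complex.exp s‖) ∨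
      (‖a‖ ≤ q * ‖ρ‖ ∧ ‖a * Complex.exp s‖ ≤ q * ‖ρ‖)) := by
    intro ρ hρ
    have hρ0 : ρ ≠ 0 := fun h => hS0 (h ▸ hρ)
    refine ⟨hρ0, ?_⟩
    -- A root `a * exp t` is a zero of `f`, so `|t.re| > δ`; its sign says whether the root is
    -- outside or inside. Since `s` uses up at most `δ / 2`, the ratio `q = exp (-(δ / 2))` is left
    -- on both circles.
    set t := Complex.log (ρ / a) with ht
    have het : a * Complex.exp t = ρ := by
      rw [ht, Complex.exp_log (div_ne_zero hρ0 ha0)]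
      field_simp
    have hz : eval f (cexpTorus (w + Pi.single i t)) = 0 := by
      rw [hev, het, Multiset.prod_eq_zero, mul_zero]
      exact Multiset.mem_map.2 ⟨ρ, hρ, sub_self ρ⟩
    have htre : δ < |t.re| := by
      by_contra h
      exact hδ t (not_lt.1 h) hz
    have hρn : ‖ρ‖ = ‖a‖ * Real.exp t.re := by rw [← het, norm_mul, Complex.norm_exp t]
    rw [haS, hρn]
    obtain ⟨hs1, hs2⟩ := abs_le.1 hs
    rcases lt_abs.1 htre with h | h
    · right
      have h1 : 1 ≤ q * Real.exp t.re := by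
        rw [hqdef, ← Real.exp_add]; exact Real.one_le_exp (by linarith)
      have h2 : Real.exp s.re ≤ q * Real.exp t.re := by
        rw [hqdef, ← Real.exp_add]; exact Real.exp_le_exp.2 (by linarith)
      constructor <;> nlinarith
    · left
      have h1 : Real.exp t.re ≤ q := by
        rw [hqdef]; exact Real.exp_le_exp.2 (by linarith)
      have h2 : Real.exp t.re ≤ q * Real.exp s.re := by
        rw [hqdef, ← Real.exp_add]; exact Real.exp_le_exp.2 (by linarith)
      constructor <;> nlinarith
  obtain ⟨l, hl, hlb⟩ := exists_multiset_prod_pow_sub_pow ha0 hq1 hq S hroot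
  have hprod (s : ℂ) : ∏ k : Fin n, eval f (cexpTorus (w + Pi.single i
        (s + 2 * Real.pi * Complex.I * ((k : ℕ) : ℂ) / (n : ℂ)))) =
      c ^ n * (∏ k : Fin n, (a * Complex.exp
        (2 * Real.pi * Complex.I * ((k : ℕ) : ℂ) / (n : ℂ))) ^ m) * Complex.exp (n * m * s) *
      (((-1) ^ n) ^ S.card * (S.map fun ρ => ρ ^ n - (a * Complex.exp s) ^ n).prod) := by
    have h1 : (S.map fun ρ => ∏ k : Fin n, (a * Complex.exp s *
        Complex.exp (2 * Real.pi * Complex.I * ((k : ℕ) : ℂ) / (n : ℂ)) - ρ)).prod =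
        ((-1) ^ n) ^ S.card * (S.map fun ρ => ρ ^ n - (a * Complex.exp s) ^ n).prod := by
      simp_rw [prod_root_sub hn]
      rw [Multiset.prod_map_mul, Multiset.map_const', Multiset.prod_replicate]
    -- Exchanging the products over rotations and over roots. The constants and signs do not depend
    -- on `s` and so agree at `s` and at `0`.
    rw [← h1]
    have h2 : (S.map fun ρ => ∏ k : Fin n, (a * Complex.exp s *
        Complex.exp (2 * Real.pi * Complex.I * ((k : ℕ) : ℂ) / (n : ℂ)) - ρ)).prod =
        ∏ k : Fin n, (S.map fun ρ => (a * Complex.exp s *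
        Complex.exp (2 * Real.pi * Complex.I * ((k : ℕ) : ℂ) / (n : ℂ)) - ρ)).prod :=
      Multiset.prod_map_prod
    rw [h2]
    have h3 : Complex.exp (n * m * s) = ∏ _k : Fin n, Complex.exp s ^ m := by
      rw [Finset.prod_const, Finset.card_univ, Fintype.card_fin, ← Complex.exp_int_mul,
        ← Complex.exp_nat_mul]
      ring_nf
    have h4 : c ^ n = ∏ _k : Fin n, c := by simp
    rw [h3, h4, ← Finset.prod_mul_distrib, ← Finset.prod_mul_distrib, ← Finset.prod_mul_distrib]
    refine Finset.prod_congr rfl fun k _ => ?_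
    rw [hev, Complex.exp_add]
    simp only [mul_zpow, mul_assoc]
    ring
  refine ⟨l, ?_, hlb.trans ?_⟩
  · have h0 := hprod 0
    simp only [zero_add] at h0
    have hidx : (index f (cexpTorus w) i : ℂ) = (S.countP fun ρ => ‖ρ‖ < ‖a‖ : ℕ) + m := by
      simp only [index, hcount, ← hm]
      push_cast
      rfl
    rw [hprod, h0, hl, hidx]
    simp only [mul_zero, Complex.exp_zero, mul_one]
    rw [show (n : ℂ) * ((S.countP fun ρ => ‖ρ‖ < ‖a‖ : ℕ) + m) * s =
      n * (S.countP fun ρ => ‖ρ‖ < ‖a‖ : ℕ) * s + n * m * s by ring, Complex.exp_add]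
    ring
  · have : (S.card : ℝ) ≤ B - A := by
      have : (S.card : ℤ) ≤ B - A := by linarith
      exact_mod_cast this
    gcongr

/-- The shift by the real number `δ / 2` makes the index readable from values of `f` alone: it is a
difference quotient of `log ‖·‖`, up to an exponentially small error. -/
theorem abs_log_prod_shift_le {f : Laurent r} {w : Fin r → ℂ} {i : Fin r} {δ : ℝ} (hδ0 : 0 < δ)
    (hδ : ∀ s : ℂ, |s.re| ≤ δ → eval f (cexpTorus (w + Pi.single i s)) ≠ 0) {A B : ℤ}
    (hA : ∀ j ∈ f.coeff.support, A ≤ j i) (hB : ∀ j ∈ f.coeff.support, j i ≤ B)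
    {n : ℕ} (hn : 0 < n) (hq : Real.exp (-(δ / 2)) ^ n ≤ 1 / 2) :
    |Real.log ‖∏ k : Fin n, eval f (cexpTorus (w + Pi.single i
        ((δ / 2 : ℝ) + 2 * Real.pi * Complex.I * ((k : ℕ) : ℂ) / (n : ℂ))))‖ -
      Real.log ‖∏ k : Fin n, eval f (cexpTorus (w + Pi.single i
        (2 * Real.pi * Complex.I * ((k : ℕ) : ℂ) / (n : ℂ))))‖ -
      n * index f (cexpTorus w) i * (δ / 2)| ≤ 3 * (B - A) * Real.exp (-(δ / 2)) ^ n := by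
  obtain ⟨l, hl, hlb⟩ := exists_prod_shift_eq hδ0 hδ hA hB hn hq (s := ((δ / 2 : ℝ) : ℂ))
    (by rw [Complex.ofReal_re, abs_of_pos (by positivity)])
  have hne : ∏ k : Fin n, eval f (cexpTorus (w + Pi.single i
        (2 * Real.pi * Complex.I * ((k : ℕ) : ℂ) / (n : ℂ)))) ≠ 0 := by
    refine Finset.prod_ne_zero_iff.2 fun k _ => hδ _ ?_
    have : (2 * Real.pi * Complex.I * ((k : ℕ) : ℂ) / (n : ℂ)).re = 0 := by
      rw [Complex.div_natCast_re]
      simp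
    rw [this, abs_zero]
    exact hδ0.le
  have h1 : (n * (index f (cexpTorus w) i : ℂ) * ((δ / 2 : ℝ) : ℂ)) =
    ((n * index f (cexpTorus w) i * (δ / 2) : ℝ) : ℂ) := by push_cast; rfl
  rw [hl, norm_mul, norm_mul, Real.log_mul (mul_ne_zero (norm_ne_zero_iff.2 hne)
    (norm_ne_zero_iff.2 (Complex.exp_ne_zero _))) (norm_ne_zero_iff.2 (Complex.exp_ne_zero _)),
    Real.log_mul (norm_ne_zero_iff.2 hne) (norm_ne_zero_iff.2 (Complex.exp_ne_zero _)),
    Complex.norm_exp, Complex.norm_exp, Real.log_exp, Real.log_exp, h1, Complex.ofReal_re]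
  rw [show ∀ a b c : ℝ, a + b + c - a - b = c by intros; ring]
  exact (Complex.abs_re_le_norm l).trans hlb

/-! ### Local constancy of the index -/

theorem cexpTorus_congr {w w' : Fin r → ℂ}
    (h : ∀ i, ∃ k : ℤ, w i = w' i + k * (2 * Real.pi * Complex.I)) :
    cexpTorus w = cexpTorus w' := by
  funext i
  ext
  exact Complex.exp_eq_exp_iff_exists_int.2 (h i)

theorem exists_mem_Icc_add_two_pi (φ : ℝ) :
    ∃ k : ℤ, ∃ ψ ∈ Set.Icc 0 (2 * Real.pi), φ = ψ + k * (2 * Real.pi) := by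
  refine ⟨toIcoDiv Real.two_pi_pos 0 φ, toIcoMod Real.two_pi_pos 0 φ, ?_, ?_⟩
  · have := toIcoMod_mem_Ico Real.two_pi_pos 0 φ
    rw [zero_add] at this
    exact Set.Ico_subset_Icc_self this
  · have := toIcoMod_add_toIcoDiv_zsmul Real.two_pi_pos 0 φ
    rw [zsmul_eq_mul] at this
    exact this.symm

theorem continuous_eval_cexpTorus (f : Laurent r) :
    Continuous fun w : Fin r → ℂ => eval f (cexpTorus w) := by
  simp only [eval, Finsupp.sum, monomialEval, cexpTorus, Units.val_mk0]
  refine continuous_finsetSum _ fun j _ => continuous_const.mul <|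
    continuous_finsetProd _ fun i _ => ?_
  exact Continuous.zpow₀ (Complex.continuous_exp.comp (continuous_apply i)) _
    fun w => Or.inl (Complex.exp_ne_zero _)

/-- Nonvanishing on the compact circle persists on a neighbourhood uniform in the angle; periodicity
then reduces every imaginary part to `[0, 2π]`. -/
theorem exists_strip {X : Type*} [TopologicalSpace X] {f : X → Laurent r} {w : X → Fin r → ℂ}
    {i : Fin r}
    (hcont : Continuous fun p : X × ℂ => eval (f p.1) (cexpTorus (w p.1 + Pi.single i p.2)))
    {τ₀ : X} (h0 : ∀ φ : ℝ, eval (f τ₀) (cexpTorus (w τ₀ + Pi.single i (φ * Complex.I))) ≠ 0) :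
    ∃ δ > 0, ∀ᶠ τ in nhds τ₀, ∀ s : ℂ, |s.re| ≤ δ →
      eval (f τ) (cexpTorus (w τ + Pi.single i s)) ≠ 0 := by
  have hc : Continuous fun p : (X × ℝ) × ℝ =>
      eval (f p.1.1) (cexpTorus (w p.1.1 + Pi.single i ((p.1.2 : ℂ) + p.2 * Complex.I))) :=
    hcont.comp (f := fun p : (X × ℝ) × ℝ => (p.1.1, (p.1.2 : ℂ) + p.2 * Complex.I)) (by fun_prop)
  have h1 : ∀ᶠ p in nhds (τ₀, (0 : ℝ)), ∀ φ ∈ Set.Icc (0 : ℝ) (2 * Real.pi),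
      eval (f p.1) (cexpTorus (w p.1 + Pi.single i ((p.2 : ℂ) + φ * Complex.I))) ≠ 0 := by
    refine isCompact_Icc.eventually_forall_of_forall_eventually fun φ _ => ?_
    exact hc.continuousAt.eventually_ne (by simpa using h0 φ)
  rw [nhds_prod_eq, Filter.eventually_prod_iff] at h1
  obtain ⟨P, hP, Q, hQ, h⟩ := h1
  obtain ⟨ε, hε, hQ⟩ := Metric.eventually_nhds_iff.1 hQ
  refine ⟨ε / 2, by positivity, hP.mono fun τ hτ s hs => ?_⟩
  obtain ⟨k, ψ, hψ, hk⟩ := exists_mem_Icc_add_two_pi s.im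
  have h2 := h hτ (hQ (y := s.re) (by rw [Real.dist_0_eq_abs]; linarith)) ψ hψ
  convert h2 using 2
  refine cexpTorus_congr fun l => ?_
  rcases eq_or_ne l i with rfl | hl
  · refine ⟨k, ?_⟩
    simp only [Pi.add_apply, Pi.single_eq_same]
    conv_lhs => rw [← Complex.re_add_im s, hk]
    push_cast
    ring
  · exact ⟨0, by simp [hl]⟩

theorem exists_pow_small {q C ε : ℝ} (hq0 : 0 ≤ q) (hq : q < 1) (hε : 0 < ε) :
    ∀ᶠ n : ℕ in Filter.atTop, 0 < n ∧ q ^ n ≤ 1 / 2 ∧ C * q ^ n < ε := by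
  have h := tendsto_pow_atTop_nhds_zero_of_lt_one hq0 hq
  have h' := h.const_mul C
  rw [mul_zero] at h'
  filter_upwards [Filter.eventually_gt_atTop 0, h.eventually_lt_const one_half_pos,
    h'.eventually_lt_const hε] with n h1 h2 h3
  exact ⟨h1, h2.le, h3⟩

/-- The entries of the index are locally constant in continuous families. -/
theorem eventually_index_eq {X : Type*} [TopologicalSpace X] {f : X → Laurent r}
    {w : X → Fin r → ℂ} {i : Fin r}
    (hcont : Continuous fun p : X × ℂ => eval (f p.1) (cexpTorus (w p.1 + Pi.single i p.2)))
    {A B : ℤ} (hA : ∀ τ, ∀ j ∈ (f τ).coeff.support, A ≤ j i)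
    (hB : ∀ τ, ∀ j ∈ (f τ).coeff.support, j i ≤ B) {τ₀ : X}
    (h0 : ∀ φ : ℝ, eval (f τ₀) (cexpTorus (w τ₀ + Pi.single i (φ * Complex.I))) ≠ 0) :
    ∀ᶠ τ in nhds τ₀, index (f τ) (cexpTorus (w τ)) i = index (f τ₀) (cexpTorus (w τ₀)) i := by
  obtain ⟨δ, hδ, hev⟩ := exists_strip hcont h0
  -- One fixed `n` suffices. Two errors of at most `δ / 16` and a variation of at most `δ / 16` by
  -- continuity stay below `δ / 2`, so `n` times the difference of the indices is an integer in
  -- `(-1, 1)`.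
  obtain ⟨n, hn, hq, hC⟩ := (exists_pow_small (q := Real.exp (-(δ / 2))) (C := 3 * (B - A))
    (ε := δ / 16) (Real.exp_nonneg _) (Real.exp_lt_one_iff.2 (by linarith)) (by linarith)).exists
  have hn1 : (1 : ℝ) ≤ n := by exact_mod_cast hn
  have hcont' (s : Fin n → ℂ) : Continuous fun τ =>
      ∏ k, eval (f τ) (cexpTorus (w τ + Pi.single i (s k))) :=
    continuous_finsetProd _ fun k _ =>
      hcont.comp (f := fun τ => (τ, s k)) (by fun_prop)
  have hre (k : Fin n) : (2 * Real.pi * Complex.I * ((k : ℕ) : ℂ) / (n : ℂ)).re = 0 := by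
    rw [Complex.div_natCast_re]
    simp
  have hL : ContinuousAt (fun τ => Real.log ‖∏ k : Fin n, eval (f τ) (cexpTorus (w τ +
      Pi.single i ((δ / 2 : ℝ) + 2 * Real.pi * Complex.I * ((k : ℕ) : ℂ) / (n : ℂ))))‖ -
      Real.log ‖∏ k : Fin n, eval (f τ) (cexpTorus (w τ + Pi.single i
        (2 * Real.pi * Complex.I * ((k : ℕ) : ℂ) / (n : ℂ))))‖) τ₀ := by
    refine ContinuousAt.sub ?_ ?_
    · refine (hcont' _).norm.continuousAt.log (norm_ne_zero_iff.2 (Finset.prod_ne_zero_iff.2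
        fun k _ => hev.self_of_nhds _ ?_))
      rw [Complex.add_re, hre, add_zero, Complex.ofReal_re, abs_of_pos (by positivity)]
      linarith
    · refine (hcont' _).norm.continuousAt.log (norm_ne_zero_iff.2 (Finset.prod_ne_zero_iff.2
        fun k _ => hev.self_of_nhds _ ?_))
      rw [hre, abs_zero]
      exact hδ.le
  filter_upwards [hev, hL.eventually (Metric.ball_mem_nhds _ (by positivity : 0 < δ / 16))]
    with τ h1 h2
  have e1 := abs_log_prod_shift_le hδ h1 (hA τ) (hB τ) hn hq
  have e0 := abs_log_prod_shift_le hδ hev.self_of_nhds (hA τ₀) (hB τ₀) hn hq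
  replace h2 := (Real.dist_eq _ _ ▸ Metric.mem_ball.1 h2)
  obtain ⟨e1, e1'⟩ := abs_le.1 e1
  obtain ⟨e0, e0'⟩ := abs_le.1 e0
  obtain ⟨h2, h2'⟩ := abs_lt.1 h2
  set a := index (f τ) (cexpTorus (w τ)) i
  set b := index (f τ₀) (cexpTorus (w τ₀)) i
  have h3 : (n : ℝ) * a * (δ / 2) - n * b * (δ / 2) < δ / 2 := by linarith
  have h4 : -(δ / 2) < (n : ℝ) * a * (δ / 2) - n * b * (δ / 2) := by linarith
  have h5 : n * ((a : ℝ) - b) < 1 := by nlinarith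
  have h6 : -1 < n * ((a : ℝ) - b) := by nlinarith
  have h7 : (n : ℤ) * (a - b) = 0 := by
    have h5' : (n : ℤ) * (a - b) < 1 := by exact_mod_cast h5
    have h6' : -1 < (n : ℤ) * (a - b) := by exact_mod_cast h6
    omega
  rcases mul_eq_zero.1 h7 with h8 | h8
  · omega
  · omega

/-! ### The complement of the amoeba and the index of a component -/

theorem Log_cexpTorus (w : Fin r → ℂ) (i : Fin r) : Log (cexpTorus w) i = (w i).re := by
  simp [Log, cexpTorus, Complex.norm_exp]

theorem exists_cexpTorus_eq (z : Torus r) : ∃ w, cexpTorus w = z :=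
  ⟨fun i => Complex.log (z i), by
    funext i
    ext
    simp [cexpTorus, Complex.exp_log (z i).ne_zero]⟩

/-- The vector `x + iθ`. -/
def polar (x : Space r) (θ : Fin r → ℝ) : Fin r → ℂ := fun i => (x i : ℂ) + (θ i : ℂ) * Complex.I

theorem polar_re (x : Space r) (θ : Fin r → ℝ) (i : Fin r) : (polar x θ i).re = x i := by
  simp [polar]

theorem continuous_polar : Continuous fun p : Space r × (Fin r → ℝ) => polar p.1 p.2 := by
  unfold polar
  fun_prop

theorem eq_polar {w : Fin r → ℂ} {x : Space r} (h : ∀ i, (w i).re = x i) :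
    w = polar x fun i => (w i).im := by
  funext i
  rw [polar, ← h, Complex.re_add_im]

theorem notMem_amoeba_iff {f : Laurent r} {x : Space r} :
    x ∉ amoeba f ↔ ∀ w : Fin r → ℂ, (∀ i, (w i).re = x i) → eval f (cexpTorus w) ≠ 0 := by
  constructor
  · intro h w hw h0
    refine h ⟨_, h0, ?_⟩
    ext i
    rw [Log_cexpTorus, hw]
  · rintro h ⟨z, hz, rfl⟩
    obtain ⟨w, rfl⟩ := exists_cexpTorus_eq z
    exact h w (fun i => (Log_cexpTorus w i).symm) hz

/-- The fibres of `Log` are compact tori, so nonvanishing on one fibre extends to the nearby ones.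
-/
theorem isOpen_compl_amoeba (f : Laurent r) : IsOpen (amoeba f)ᶜ := by
  rw [isOpen_iff_mem_nhds]
  intro x hx
  have h : ∀ᶠ y in nhds x, ∀ θ ∈ Set.Icc (0 : Fin r → ℝ) (fun _ => 2 * Real.pi),
      eval f (cexpTorus (polar y θ)) ≠ 0 := by
    refine isCompact_Icc.eventually_forall_of_forall_eventually fun θ _ => ?_
    exact ((continuous_eval_cexpTorus f).comp continuous_polar).continuousAt.eventually_ne
      (notMem_amoeba_iff.1 hx _ (polar_re x θ))
  filter_upwards [h] with y hy
  refine notMem_amoeba_iff.2 fun w hw => ?_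
  choose k ψ hψ hk using fun i => exists_mem_Icc_add_two_pi (w i).im
  have : cexpTorus w = cexpTorus (polar y ψ) := cexpTorus_congr fun i => ⟨k i, by
    rw [polar, ← hw, ← Complex.re_add_im (w i), hk i]
    simp
    ring⟩
  rw [this]
  exact hy ψ ⟨fun i => (hψ i).1, fun i => (hψ i).2⟩

theorem exists_support_bounds (f : Laurent r) : ∃ A B : ℤ, ∀ j ∈ f.coeff.support, ∀ i,
    A ≤ j i ∧ j i ≤ B := by
  obtain ⟨B, hB⟩ := (f.coeff.support.image fun j => ∑ i, |j i|).bddAbove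
  refine ⟨-B, B, fun j hj i => abs_le.1 (le_trans ?_ (hB (Finset.mem_coe.2
    (Finset.mem_image_of_mem _ hj))))⟩
  exact Finset.single_le_sum (f := fun i => |j i|) (fun i _ => abs_nonneg _) (Finset.mem_univ i)

/-- The index is constant over connected subsets of the complement of the amoeba. -/
theorem index_eq_of_isPreconnected {f : Laurent r} {E : Set (Space r)} (hE : IsPreconnected E)
    (hEf : E ⊆ (amoeba f)ᶜ) {w w' : Fin r → ℂ} {x x' : Space r} (hx : x ∈ E) (hx' : x' ∈ E)
    (hw : ∀ i, (w i).re = x i) (hw' : ∀ i, (w' i).re = x' i) :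
    index f (cexpTorus w) = index f (cexpTorus w') := by
  funext i
  obtain ⟨A, B, hAB⟩ := exists_support_bounds f
  -- The angles range over all of `ℝ^r`, so `E ×ˢ univ` is preconnected and both the base point and
  -- the point of its fibre may vary.
  have hc : ContinuousOn (fun p : Space r × (Fin r → ℝ) => index f (cexpTorus (polar p.1 p.2)) i)
      (E ×ˢ Set.univ) := by
    intro p hp
    have h := eventually_index_eq (X := Space r × (Fin r → ℝ)) (f := fun _ => f)
      (w := fun p => polar p.1 p.2) (i := i) (A := A) (B := B) (τ₀ := p)
      ((continuous_eval_cexpTorus f).comp (by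
        refine (continuous_polar.comp continuous_fst).add ?_
        exact (continuous_single i).comp continuous_snd))
      (fun _ j hj => (hAB j hj i).1) (fun _ j hj => (hAB j hj i).2)
      (fun φ => notMem_amoeba_iff.1 (hEf hp.1) _ fun l => by
        rcases eq_or_ne l i with rfl | hl
        · simp [polar]
        · simp [polar, hl])
    exact (continuousAt_const.congr (h.mono fun _ h => h.symm)).continuousWithinAt
  have := (hE.prod isPreconnected_univ).constant hc (x := (x, fun i => (w i).im))
    (y := (x', fun i => (w' i).im)) ⟨hx, trivial⟩ ⟨hx', trivial⟩
  rwa [eq_polar hw, eq_polar hw']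

theorem componentIndex_eq {f : Laurent r} (E : complementComponents f) {w : Fin r → ℂ}
    {x : Space r} (hx : x ∈ E.1) (hw : ∀ i, (w i).re = x i) :
    index f (cexpTorus w) = componentIndex f E := by
  obtain ⟨h1, h2⟩ := E.2.choose_spec
  have h3 : E.2.choose ∈ E.1 := by
    have := mem_connectedComponentIn h1
    rwa [← h2] at this
  have h4 : IsPreconnected E.1 := by
    rw [h2]; exact isPreconnected_connectedComponentIn
  have h5 : E.1 ⊆ (amoeba f)ᶜ := by
    rw [h2]; exact connectedComponentIn_subset _ _
  exact index_eq_of_isPreconnected h4 h5 hx h3 hw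
    (w' := fun i => (E.2.choose i : ℂ)) (fun i => Complex.ofReal_re _)

/-! ### Fourier coefficients by finite averages -/

theorem sum_exp_two_pi_mul {N : ℕ} (hN : 0 < N) {d : ℤ} (hd : d ≠ 0) (hdN : |d| < N) :
    ∑ k : Fin N, Complex.exp (2 * Real.pi * Complex.I * ((k : ℕ) : ℂ) / (N : ℂ)) ^ d = 0 := by
  have hN' : (N : ℂ) ≠ 0 := by exact_mod_cast hN.ne'
  have hω := Complex.isPrimitiveRoot_exp N hN.ne'
  set ω := Complex.exp (2 * Real.pi * Complex.I / N) with hωdef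
  have h1 (k : Fin N) : Complex.exp (2 * Real.pi * Complex.I * ((k : ℕ) : ℂ) / (N : ℂ)) ^ d =
      (ω ^ d) ^ (k : ℕ) := by
    rw [hωdef, ← Complex.exp_int_mul, ← Complex.exp_int_mul, ← Complex.exp_nat_mul]
    congr 1
    ring
  simp_rw [h1]
  rw [Fin.sum_univ_eq_sum_range (fun k => (ω ^ d) ^ k) N]
  have h2 : ω ^ d ≠ 1 := by
    intro h
    have := (hω.zpow_eq_one_iff_dvd d).1 h
    exact hd (Int.eq_zero_of_abs_lt_dvd this hdN)
  rw [geom_sum_eq h2, ← zpow_natCast, zpow_comm, zpow_natCast, hω.pow_eq_one]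
  simp

theorem sum_monomialEval_rootPoint {N : ℕ} (hN : 0 < N) {d : Fin r → ℤ} (hd : d ≠ 0)
    (hdN : ∀ i, |d i| < N) : ∑ k : Fin r → Fin N, monomialEval d 1 (rootPoint N k) = 0 := by
  obtain ⟨i, hi⟩ := Function.ne_iff.1 hd
  simp only [monomialEval, one_mul, rootPoint, Units.val_mk0]
  have := Finset.prod_univ_sum (fun _ : Fin r => (Finset.univ : Finset (Fin N)))
    (fun i k => Complex.exp (2 * Real.pi * Complex.I * ((k : ℕ) : ℂ) / (N : ℂ)) ^ d i)
  rw [Fintype.piFinset_univ] at this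
  rw [← this]
  exact Finset.prod_eq_zero (Finset.mem_univ i) (sum_exp_two_pi_mul hN hi (hdN i))

theorem monomialEval_mul_monomialEval (j j' : Fin r → ℤ) (c c' : ℂ) (z : Torus r) :
    monomialEval j c z * monomialEval j' c' z = monomialEval (j + j') (c * c') z := by
  simp only [monomialEval, Pi.add_apply, zpow_add₀ (z _).ne_zero, Finset.prod_mul_distrib]
  ring

theorem monomialEval_mul (j : Fin r → ℤ) (c : ℂ) (z z' : Torus r) :
    monomialEval j c (z * z') = monomialEval j 1 z * monomialEval j c z' := by
  simp only [monomialEval, Pi.mul_apply, Units.val_mul, mul_zpow, Finset.prod_mul_distrib]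
  ring

/-- A term of a Laurent polynomial as a finite average over roots of unity. -/
theorem exists_sum_rootPoint_eq (g : Laurent r) (j : Fin r → ℤ) : ∃ N : ℕ, 0 < N ∧
    ∀ z : Torus r, ∑ k : Fin r → Fin N,
      monomialEval (-j) 1 (rootPoint N k) * eval g (rootPoint N k * z) =
        N ^ r * monomialEval j (g.coeff j) z := by
  obtain ⟨A, B, hAB⟩ := exists_support_bounds g
  -- `N` exceeds every entry of `l - j` in absolute value for `l` in the support, so the average
  -- kills all terms but `j`.
  set N : ℕ := (|A| + |B| + ∑ i, |j i| + 1).toNat with hN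
  have hs : 0 ≤ ∑ i, |j i| := Finset.sum_nonneg fun i _ => abs_nonneg _
  have hNc : (N : ℤ) = |A| + |B| + ∑ i, |j i| + 1 := Int.toNat_of_nonneg (by positivity)
  have hN0 : 0 < N := by
    have : (0 : ℤ) < N := by rw [hNc]; positivity
    exact_mod_cast this
  refine ⟨N, hN0, fun z => ?_⟩
  have h1 (k : Fin r → Fin N) :
      monomialEval (-j) 1 (rootPoint N k) * eval g (rootPoint N k * z) =
      ∑ l ∈ g.coeff.support,
        monomialEval (l - j) 1 (rootPoint N k) * monomialEval l (g.coeff l) z := by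
    rw [eval, Finsupp.sum, Finset.mul_sum]
    refine Finset.sum_congr rfl fun l _ => ?_
    rw [monomialEval_mul, ← mul_assoc, monomialEval_mul_monomialEval, mul_one, sub_eq_neg_add]
  simp_rw [h1]
  rw [Finset.sum_comm]
  simp_rw [← Finset.sum_mul]
  have h2 : ∑ k : Fin r → Fin N, monomialEval (j - j) 1 (rootPoint N k) = (N : ℂ) ^ r := by
    simp [monomialEval]
  rw [Finset.sum_eq_single j, h2]
  · intro l hl hlj
    rw [sum_monomialEval_rootPoint hN0 (sub_ne_zero.2 hlj), zero_mul]
    intro i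
    rw [hNc, Pi.sub_apply]
    have h3 := hAB l hl i
    have h4 : |j i| ≤ ∑ i, |j i| :=
      Finset.single_le_sum (f := fun i => |j i|) (fun i _ => abs_nonneg _) (Finset.mem_univ i)
    have h5 : |l i| ≤ |A| + |B| := by
      rw [abs_le]
      constructor
      · linarith [neg_abs_le A, abs_nonneg B]
      · linarith [le_abs_self B, abs_nonneg A]
    have h6 := abs_sub (l i) (j i)
    linarith
  · intro hj
    rw [Finsupp.notMem_support_iff.1 hj]
    simp [monomialEval]

theorem norm_exp_sub_one_le {l : ℂ} {η : ℝ} (hl : ‖l‖ ≤ η) (hη : η ≤ 1 / 4) :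
    ‖Complex.exp l - 1‖ ≤ 2 * η :=
  (Complex.norm_exp_sub_one_le (by linarith)).trans (by linarith)

/-- If `g` is close to a monomial on a fibre of `Log`, then its term of that exponent is close to
the values of `g`. -/
theorem exists_coeff_eq {g : Laurent r} {j : Fin r → ℤ} {z : Torus r} {η : ℝ} (hη : η ≤ 1 / 4)
    (h : ∀ θ : Fin r → ℝ, ∃ l : ℂ, eval g (cexpTorus (fun i => θ i * Complex.I) * z) =
      eval g z * monomialEval j 1 (cexpTorus fun i => θ i * Complex.I) * Complex.exp l ∧ ‖l‖ ≤ η) :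
    ∃ l : ℂ, monomialEval j (g.coeff j) z = eval g z * Complex.exp l ∧ ‖l‖ ≤ 3 * η := by
  obtain ⟨N, hN, hsum⟩ := exists_sum_rootPoint_eq g j
  have hr (k : Fin r → Fin N) : rootPoint N k =
      cexpTorus fun i => ((2 * Real.pi * ((k i : ℕ) : ℝ) / (N : ℝ) : ℝ) : ℂ) * Complex.I := by
    funext i
    ext
    simp only [rootPoint, cexpTorus, Units.val_mk0]
    congr 1
    push_cast
    ring
  choose l hl hlη using fun k : Fin r → Fin N => h fun i => 2 * Real.pi * ((k i : ℕ) : ℝ) / (N : ℝ)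
  have h1 := hsum z
  have h2 (k : Fin r → Fin N) :
      monomialEval (-j) 1 (rootPoint N k) * eval g (rootPoint N k * z) =
        eval g z * Complex.exp (l k) := by
    rw [hr, hl, ← hr]
    have := monomialEval_mul_monomialEval (-j) j 1 1 (rootPoint N k)
    rw [neg_add_cancel, mul_one] at this
    have h0 : monomialEval (0 : Fin r → ℤ) 1 (rootPoint N k) = 1 := by simp [monomialEval]
    rw [h0] at this
    linear_combination (eval g z * Complex.exp (l k)) * this
  simp_rw [h2] at h1
  rw [← Finset.mul_sum] at h1
  have hNr : ((N : ℂ) ^ r) ≠ 0 := pow_ne_zero _ (by exact_mod_cast hN.ne')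
  -- The character cancels the monomial, leaving the average of the `exp (l k)`. It is within `2 * η
  -- ≤ 1 / 2` of 1, and its logarithm is at most `3 / 2 * (2 * η)`.
  set u : ℂ := 1 - (∑ k, Complex.exp (l k)) / N ^ r with hu
  have hun : ‖u‖ ≤ 2 * η := by
    have : u = (∑ k : Fin r → Fin N, (1 - Complex.exp (l k))) / N ^ r := by
      rw [hu, Finset.sum_sub_distrib]
      simp
      field_simp
    rw [this, norm_div, norm_pow, Complex.norm_natCast, div_le_iff₀ (by positivity)]
    refine (norm_sum_le_of_le (n := fun _ => 2 * η) _ fun k _ => ?_).trans ?_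
    · rw [norm_sub_rev]
      exact norm_exp_sub_one_le (hlη k) hη
    · simp
      linarith
  obtain ⟨l', e, hl'⟩ := exists_exp_eq_one_sub hun (by linarith)
  refine ⟨l', ?_, hl'.trans (by linarith)⟩
  rw [← e, hu]
  field_simp
  linear_combination -h1

/-! ### Means of periodic functions -/

/-- The mean of a `2π`-periodic function. -/
def torusMean (h : (Fin r → ℝ) → ℝ) : ℝ :=
  ∫ x in {x : Fin r → ℝ | ∀ i, x i ∈ Set.Ioc (0 : ℝ) (0 + 1)}, h ((2 * Real.pi) • x)

/-- A periodic function descends to the torus, and its integral over any unit cube, wherever placed,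
is the integral over the torus. -/
theorem torusMean_comp_add {h : (Fin r → ℝ) → ℝ}
    (hper : ∀ (θ : Fin r → ℝ) (k : Fin r → ℤ), h (fun i => θ i + k i * (2 * Real.pi)) = h θ)
    (a : Fin r → ℝ) : torusMean (fun θ => h (θ + a)) = torusMean h := by
  set F : UnitAddTorus (Fin r) → ℝ := fun y =>
    h ((2 * Real.pi) • fun i => ((AddCircle.equivIoc 1 0 (y i)).1 : ℝ)) with hF
  have hFx (x : Fin r → ℝ) : F (fun i => (x i : UnitAddCircle)) = h ((2 * Real.pi) • x) := by
    rw [hF]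
    have hk (i : Fin r) : ∃ k : ℤ, x i = (AddCircle.equivIoc (1 : ℝ) 0 (x i)).1 + k := by
      have h1 := (AddCircle.equivIoc (1 : ℝ) 0).symm_apply_apply (x i)
      have h2 : (((AddCircle.equivIoc (1 : ℝ) 0 (x i)).1 : ℝ) : UnitAddCircle) = x i := h1
      obtain ⟨k, hk⟩ := AddSubgroup.mem_zmultiples_iff.1 (QuotientAddGroup.eq.1 h2)
      refine ⟨k, ?_⟩
      rw [zsmul_eq_mul, mul_one] at hk
      linarith
    choose k hk using hk
    have : (2 * Real.pi) • x = fun i => ((2 * Real.pi) • fun i =>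
        ((AddCircle.equivIoc (1 : ℝ) 0 (x i)).1 : ℝ)) i + k i * (2 * Real.pi) := by
      funext i
      simp only [Pi.smul_apply, smul_eq_mul]
      conv_lhs => rw [hk i]
      ring
    rw [this, hper]
  have h1 (b : Fin r → ℝ) := UnitAddTorus.integral_preimage F b
  simp_rw [hFx] at h1
  set a' : Fin r → ℝ := (2 * Real.pi)⁻¹ • a with ha'
  have h2 : (2 * Real.pi) • a' = a := smul_inv_smul₀ Real.two_pi_pos.ne' a
  have h3 := (MeasureTheory.measurePreserving_add_right (MeasureTheory.volume)
    a').setIntegral_preimage_emb (MeasurableEquiv.addRight a').measurableEmbedding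
    (fun x => h ((2 * Real.pi) • x)) {x : Fin r → ℝ | ∀ i, x i ∈ Set.Ioc (a' i) (a' i + 1)}
  rw [← h1 a', h1 0] at h3
  unfold torusMean
  rw [show ∫ x in {x : Fin r → ℝ | ∀ i, x i ∈ Set.Ioc (0 : ℝ) (0 + 1)}, h ((2 * Real.pi) • x) = _
    from h3.symm]
  have h4 : ((fun x => x + a') ⁻¹' {x : Fin r → ℝ | ∀ i, x i ∈ Set.Ioc (a' i) (a' i + 1)}) =
      {x : Fin r → ℝ | ∀ i, x i ∈ Set.Ioc (0 : ℝ) (0 + 1)} := by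
    ext x
    simp [add_comm]
  rw [h4]
  simp_rw [smul_add, h2]

-- The substitution `θ = 2π x` absorbs the factor `(2π)^{-r}`, and the closed and half-open cubes
-- differ by a null set.
open Pointwise in
theorem ronkin_eq_torusMean (f : Laurent r) (x : Space r) :
    ronkin f x = torusMean fun θ => Real.log ‖eval f (cexpTorus (polar x θ))‖ := by
  have hs : Set.Icc (0 : Fin r → ℝ) (fun _ => 2 * Real.pi) =
      (2 * Real.pi) • Set.Icc (0 : Fin r → ℝ) (fun _ => 1) := by
    have hp := Real.two_pi_pos
    ext y
    rw [Set.mem_smul_set_iff_inv_smul_mem₀ hp.ne']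
    simp only [Set.mem_Icc, Pi.le_def, Pi.smul_apply, Pi.zero_apply, smul_eq_mul,
      inv_mul_le_iff₀ hp, mul_one, mul_nonneg_iff_of_pos_left (inv_pos.2 hp)]
  have h1 := MeasureTheory.Measure.setIntegral_comp_smul_of_pos
    (MeasureTheory.volume : MeasureTheory.Measure (Fin r → ℝ))
    (fun θ => Real.log ‖eval f (cexpTorus (polar x θ))‖)
    (Set.Icc (0 : Fin r → ℝ) (fun _ => 1)) Real.two_pi_pos
  rw [← hs, Module.finrank_fin_fun, smul_eq_mul] at h1
  rw [torusMean]
  refine Eq.trans h1.symm ?_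
  refine MeasureTheory.setIntegral_congr_set ?_
  have := MeasureTheory.Measure.univ_pi_Ioc_ae_eq_Icc
    (μ := fun _ : Fin r => (MeasureTheory.volume : MeasureTheory.Measure ℝ))
    (f := fun _ => 0) (g := fun _ => 1)
  have hset : (Set.univ.pi fun _ : Fin r => Set.Ioc (0 : ℝ) 1) =
      {x : Fin r → ℝ | ∀ i, x i ∈ Set.Ioc (0 : ℝ) (0 + 1)} := by
    ext; simp
  rw [← hset]
  exact this.symm

theorem integrableOn_cube {h : (Fin r → ℝ) → ℝ} (hc : Continuous h) :
    MeasureTheory.IntegrableOn (fun x => h ((2 * Real.pi) • x))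
      {x : Fin r → ℝ | ∀ i, x i ∈ Set.Ioc (0 : ℝ) (0 + 1)} := by
  have : Continuous fun x => h ((2 * Real.pi) • x) := hc.comp (continuous_const_smul _)
  refine (this.integrableOn_Icc (a := 0) (b := fun _ => 1)).mono_set fun x hx => ?_
  exact ⟨fun i => (hx i).1.le, fun i => by simpa using (hx i).2⟩

theorem torusMean_sum {ι : Type*} (s : Finset ι) {h : ι → (Fin r → ℝ) → ℝ}
    (hc : ∀ i ∈ s, Continuous (h i)) :
    torusMean (fun θ => ∑ i ∈ s, h i θ) = ∑ i ∈ s, torusMean (h i) :=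
  MeasureTheory.integral_finsetSum s fun i hi => integrableOn_cube (hc i hi)

theorem abs_torusMean_sub_le {h : (Fin r → ℝ) → ℝ} (hc : Continuous h) {c η : ℝ}
    (hη : ∀ θ, |h θ - c| ≤ η) : |torusMean h - c| ≤ η := by
  have hv : MeasureTheory.volume {x : Fin r → ℝ | ∀ i, x i ∈ Set.Ioc (0 : ℝ) (0 + 1)} = 1 := by
    have : {x : Fin r → ℝ | ∀ i, x i ∈ Set.Ioc (0 : ℝ) (0 + 1)} =
        Set.univ.pi fun _ => Set.Ioc (0 : ℝ) (0 + 1) := by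
      ext; simp
    rw [this, MeasureTheory.volume_pi_pi]
    simp
  have h1 := MeasureTheory.norm_setIntegral_le_of_norm_le_const
    (μ := MeasureTheory.volume) (s := {x : Fin r → ℝ | ∀ i, x i ∈ Set.Ioc (0 : ℝ) (0 + 1)})
    (f := fun x => h ((2 * Real.pi) • x) - c) (C := η) (by rw [hv]; simp)
    (fun x _ => hη _)
  rw [MeasureTheory.integral_sub (integrableOn_cube hc)
    (MeasureTheory.integrableOn_const (by rw [hv]; simp)), MeasureTheory.setIntegral_const,
    MeasureTheory.measureReal_def, hv] at h1
  simpa [torusMean] using h1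

/-! ### Cyclic resultants on a fibre outside the amoeba -/

/-- The exponents of the coordinates of `rootPoint n k`. -/
def rootVec (n : ℕ) (k : Fin r → Fin n) : Fin r → ℂ := fun i =>
  2 * Real.pi * Complex.I * ((k i : ℕ) : ℂ) / (n : ℂ)

theorem re_two_pi_mul_div (n k : ℕ) :
    (2 * Real.pi * Complex.I * (k : ℂ) / (n : ℂ)).re = 0 := by
  rw [Complex.div_natCast_re]
  simp

theorem eval_cyclicResultant_cexpTorus (n : ℕ) (f : Laurent r) (w : Fin r → ℂ) :
    eval (cyclicResultant n f) (cexpTorus w) =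
      ∏ k : Fin r → Fin n, eval f (cexpTorus (rootVec n k + w)) := by
  rw [eval_cyclicResultant]
  refine Finset.prod_congr rfl fun k _ => ?_
  rw [cexpTorus_add]
  rfl

/-- The vector with the coordinates of `rootVec n k` other than the `i`-th one. -/
def partialRootVec (n : ℕ) (i : Fin r) (k : {j // j ≠ i} → Fin n) : Fin r → ℂ := fun j =>
  if h : j ≠ i then 2 * Real.pi * Complex.I * ((k ⟨j, h⟩ : ℕ) : ℂ) / (n : ℂ) else 0

theorem partialRootVec_re (n : ℕ) (i : Fin r) (k : {j // j ≠ i} → Fin n) (l : Fin r) :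
    (partialRootVec n i k l).re = 0 := by
  unfold partialRootVec
  split_ifs with h
  · exact re_two_pi_mul_div _ _
  · rfl

theorem eval_cyclicResultant_eq_prod_prod (n : ℕ) (f : Laurent r) (i : Fin r) (w : Fin r → ℂ) :
    eval (cyclicResultant n f) (cexpTorus w) =
      ∏ k : {j // j ≠ i} → Fin n, ∏ l : Fin n, eval f (cexpTorus (partialRootVec n i k + w +
        Pi.single i (2 * Real.pi * Complex.I * ((l : ℕ) : ℂ) / (n : ℂ)))) := by
  have hswap (Φ : ({j // j ≠ i} → Fin n) → Fin n → ℂ) :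
      ∏ k, ∏ l, Φ k l = ∏ p : Fin n × ({j // j ≠ i} → Fin n), Φ p.2 p.1 := by
    rw [Fintype.prod_prod_type, Finset.prod_comm]
  rw [eval_cyclicResultant_cexpTorus, hswap]
  refine Fintype.prod_equiv (Equiv.funSplitAt i (Fin n)) _ _ fun k => ?_
  congr 2
  funext j
  rcases eq_or_ne j i with rfl | h
  · simp [rootVec, partialRootVec]
    ring
  · simp [rootVec, partialRootVec, h]

theorem exists_prod_eq_exp {ι : Type*} (s : Finset ι) {a b : ι → ℂ} {c : ℂ} {η : ℝ}
    (h : ∀ k ∈ s, ∃ l : ℂ, a k = b k * Complex.exp c * Complex.exp l ∧ ‖l‖ ≤ η) :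
    ∃ l : ℂ, ∏ k ∈ s, a k = (∏ k ∈ s, b k) * Complex.exp (s.card * c) * Complex.exp l ∧
      ‖l‖ ≤ s.card * η := by
  classical
  induction s using Finset.induction_on with
  | empty => exact ⟨0, by simp, by simp⟩
  | insert k s hk ih =>
    obtain ⟨l, e, b1⟩ := ih fun k hk => h k (Finset.mem_insert_of_mem hk)
    obtain ⟨l', e', b2⟩ := h k (Finset.mem_insert_self k s)
    refine ⟨l' + l, ?_, (norm_add_le _ _).trans ?_⟩
    · rw [Finset.prod_insert hk, Finset.prod_insert hk, e, e', Finset.card_insert_of_notMem hk,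
        Complex.exp_add]
      push_cast
      rw [add_mul, one_mul, Complex.exp_add]
      ring
    · rw [Finset.card_insert_of_notMem hk]
      push_cast
      linarith

/-- The change of the cyclic resultant in one coordinate. -/
theorem exists_cyclicResultant_add_single {f : Laurent r} {x : Space r} {i : Fin r} {δ : ℝ}
    (hδ0 : 0 < δ)
    (hδ : ∀ w : Fin r → ℂ, (∀ i, (w i).re = x i) → ∀ s : ℂ, |s.re| ≤ δ →
      eval f (cexpTorus (w + Pi.single i s)) ≠ 0) {A B : ℤ}
    (hA : ∀ j ∈ f.coeff.support, A ≤ j i) (hB : ∀ j ∈ f.coeff.support, j i ≤ B)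
    {v : ℤ} (hv : ∀ w : Fin r → ℂ, (∀ i, (w i).re = x i) → index f (cexpTorus w) i = v)
    {n : ℕ} (hn : 0 < n) (hq : Real.exp (-(δ / 2)) ^ n ≤ 1 / 2) {w : Fin r → ℂ}
    (hw : ∀ i, (w i).re = x i) {s : ℂ} (hs : |s.re| ≤ δ / 2) :
    ∃ l : ℂ, eval (cyclicResultant n f) (cexpTorus (w + Pi.single i s)) =
      eval (cyclicResultant n f) (cexpTorus w) * Complex.exp (n ^ r * v * s) * Complex.exp l ∧
      ‖l‖ ≤ n ^ r * (3 * |(B : ℝ) - A| * Real.exp (-(δ / 2)) ^ n) := by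
  have hr : 0 < r := i.pos
  obtain ⟨l, hl, hlb⟩ := exists_prod_eq_exp (Finset.univ : Finset ({j // j ≠ i} → Fin n))
    (a := fun k => ∏ l : Fin n, eval f (cexpTorus (partialRootVec n i k + w +
      Pi.single i (s + 2 * Real.pi * Complex.I * ((l : ℕ) : ℂ) / (n : ℂ)))))
    (b := fun k => ∏ l : Fin n, eval f (cexpTorus (partialRootVec n i k + w +
      Pi.single i (2 * Real.pi * Complex.I * ((l : ℕ) : ℂ) / (n : ℂ)))))
    (c := n * v * s) (η := 3 * |(B : ℝ) - A| * Real.exp (-(δ / 2)) ^ n) (fun k _ => by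
      have hre : ∀ j, ((partialRootVec n i k + w) j).re = x j := fun j => by
        rw [Pi.add_apply, Complex.add_re, partialRootVec_re, zero_add, hw]
      obtain ⟨l, e, b⟩ := exists_prod_shift_eq hδ0 (hδ _ hre) hA hB hn hq hs
      rw [hv _ hre] at e
      refine ⟨l, e, b.trans ?_⟩
      gcongr
      exact le_abs_self _)
  -- Each of the `n ^ (r - 1)` choices of the other rotations contributes degree `n * v`, which
  -- gives `n ^ r * v` in total.
  have hcard : (Finset.univ : Finset ({j // j ≠ i} → Fin n)).card = n ^ (r - 1) := by
    simp
  have hpow : (n : ℂ) ^ (r - 1) * n = n ^ r := by rw [← pow_succ, Nat.sub_add_cancel hr]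
  refine ⟨l, ?_, hlb.trans ?_⟩
  · rw [eval_cyclicResultant_eq_prod_prod n f i, eval_cyclicResultant_eq_prod_prod n f i w]
    rw [hcard] at hl
    push_cast at hl
    rw [← hpow, show (n : ℂ) ^ (r - 1) * n * v * s = (n : ℂ) ^ (r - 1) * (n * v * s) by ring, ← hl]
    refine Finset.prod_congr rfl fun k _ => Finset.prod_congr rfl fun l _ => ?_
    rw [Pi.single_add]
    congr 2
    abel
  · rw [hcard]
    push_cast
    gcongr
    · exact_mod_cast hn
    · omega

theorem exists_strip_of_notMem_amoeba {f : Laurent r} {x : Space r} (hx : x ∉ amoeba f) :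
    ∃ δ > 0, ∀ (i : Fin r) (w : Fin r → ℂ), (∀ i, (w i).re = x i) → ∀ s : ℂ, |s.re| ≤ δ →
      eval f (cexpTorus (w + Pi.single i s)) ≠ 0 := by
  obtain ⟨ε, hε, h⟩ := Metric.isOpen_iff.1 (isOpen_compl_amoeba f) x hx
  refine ⟨ε / 2, by positivity, fun i w hw s hs => ?_⟩
  have hy : x + EuclideanSpace.single i s.re ∈ Metric.ball x ε := by
    rw [Metric.mem_ball, dist_self_add_left, PiLp.norm_single, Real.norm_eq_abs]
    linarith
  refine notMem_amoeba_iff.1 (h hy) _ fun l => ?_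
  rcases eq_or_ne l i with rfl | hl
  · simp [hw]
  · simp [hw, hl]

theorem polar_add_single (x : Space r) (θ : Fin r → ℝ) (T : Finset (Fin r)) {i : Fin r}
    (hi : i ∉ T) : polar x ((insert i T).piecewise θ 0) =
      polar x (T.piecewise θ 0) + Pi.single i (θ i * Complex.I) := by
  funext l
  rcases eq_or_ne l i with rfl | hl
  · simp [polar, hi]
  · by_cases h : l ∈ T <;> simp [polar, hl, h]

/-- On a fibre of `Log` outside the amoeba, the cyclic resultant is close to a monomial whose
exponent is given by the index. -/
theorem exists_cyclicResultant_polar {f : Laurent r} {x : Space r} {δ : ℝ}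
    (hδ0 : 0 < δ)
    (hδ : ∀ (i : Fin r) (w : Fin r → ℂ), (∀ i, (w i).re = x i) → ∀ s : ℂ, |s.re| ≤ δ →
      eval f (cexpTorus (w + Pi.single i s)) ≠ 0) {A B : ℤ}
    (hAB : ∀ j ∈ f.coeff.support, ∀ i, A ≤ j i ∧ j i ≤ B)
    {v : Fin r → ℤ} (hv : ∀ w : Fin r → ℂ, (∀ i, (w i).re = x i) → index f (cexpTorus w) = v)
    {n : ℕ} (hn : 0 < n) (hq : Real.exp (-(δ / 2)) ^ n ≤ 1 / 2) (θ : Fin r → ℝ) :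
    ∃ l : ℂ, eval (cyclicResultant n f) (cexpTorus (polar x θ)) =
      eval (cyclicResultant n f) (cexpTorus (polar x 0)) *
        Complex.exp (n ^ r * ∑ i, v i * (θ i * Complex.I)) * Complex.exp l ∧
      ‖l‖ ≤ r * (n ^ r * (3 * |(B : ℝ) - A| * Real.exp (-(δ / 2)) ^ n)) := by
  -- The angles are switched on one coordinate at a time, each at the cost of one error term.
  suffices h : ∀ T : Finset (Fin r), ∃ l : ℂ,
      eval (cyclicResultant n f) (cexpTorus (polar x (T.piecewise θ 0))) =
      eval (cyclicResultant n f) (cexpTorus (polar x 0)) *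
        Complex.exp (n ^ r * ∑ i ∈ T, v i * (θ i * Complex.I)) * Complex.exp l ∧
      ‖l‖ ≤ T.card * (n ^ r * (3 * |(B : ℝ) - A| * Real.exp (-(δ / 2)) ^ n)) by
    simpa using h Finset.univ
  intro T
  induction T using Finset.induction_on with
  | empty => exact ⟨0, by simp, by simp⟩
  | insert i T hi ih =>
    obtain ⟨l, e, b⟩ := ih
    obtain ⟨l', e', b'⟩ := exists_cyclicResultant_add_single hδ0 (hδ i)
      (fun j hj => (hAB j hj i).1) (fun j hj => (hAB j hj i).2) (fun w hw => by rw [hv w hw])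
      hn hq (polar_re x (T.piecewise θ 0)) (s := θ i * Complex.I)
      (by simp; positivity)
    refine ⟨l + l', ?_, (norm_add_le _ _).trans ?_⟩
    · rw [polar_add_single x θ T hi, e', e, Finset.sum_insert hi, mul_add, Complex.exp_add,
        Complex.exp_add, show (n : ℂ) ^ r * v i * (θ i * Complex.I) =
          n ^ r * (v i * (θ i * Complex.I)) by ring]
      ring
    · rw [Finset.card_insert_of_notMem hi]
      push_cast
      linarith

/-! ### Asymptotics of the dominant coefficient -/

theorem log_norm_eq_of_eq_mul_exp {a b l : ℂ} (hb : b ≠ 0) (h : a = b * Complex.exp l) :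
    Real.log ‖a‖ = Real.log ‖b‖ + l.re := by
  rw [h, norm_mul, Complex.norm_exp, Real.log_mul (norm_ne_zero_iff.2 hb) (Real.exp_ne_zero _),
    Real.log_exp]

/-- `log |f_n|` is a sum of `n ^ r` rotates of `log |f|`, so its mean over the fibre is `n ^ r *
ronkin f x`; a nearly constant function is close to its mean. -/
theorem abs_log_sub_ronkin_le {f : Laurent r} {x : Space r} (hx : x ∉ amoeba f) {n : ℕ} {η : ℝ}
    (h : ∀ θ : Fin r → ℝ, |Real.log ‖eval (cyclicResultant n f) (cexpTorus (polar x θ))‖ -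
      Real.log ‖eval (cyclicResultant n f) (cexpTorus (polar x 0))‖| ≤ η) :
    |n ^ r * ronkin f x - Real.log ‖eval (cyclicResultant n f) (cexpTorus (polar x 0))‖| ≤ η := by
  set H : (Fin r → ℝ) → ℝ := fun θ => Real.log ‖eval f (cexpTorus (polar x θ))‖ with hH
  have hne (θ : Fin r → ℝ) : eval f (cexpTorus (polar x θ)) ≠ 0 :=
    notMem_amoeba_iff.1 hx _ (polar_re x θ)
  have hHc : Continuous H := by
    refine Continuous.log ?_ fun θ => norm_ne_zero_iff.2 (hne θ)
    exact ((continuous_eval_cexpTorus f).comp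
      (continuous_polar.comp (Continuous.prodMk_right x))).norm
  have hper (θ : Fin r → ℝ) (k : Fin r → ℤ) : H (fun i => θ i + k i * (2 * Real.pi)) = H θ := by
    simp only [hH]
    rw [cexpTorus_congr (w' := polar x θ) fun i => ⟨k i, by simp [polar]; ring⟩]
  have hlog (θ : Fin r → ℝ) : Real.log ‖eval (cyclicResultant n f) (cexpTorus (polar x θ))‖ =
      ∑ k : Fin r → Fin n, H (θ + fun i => 2 * Real.pi * (k i : ℕ) / n) := by
    rw [eval_cyclicResultant_cexpTorus, norm_prod, Real.log_prod]
    · refine Finset.sum_congr rfl fun k _ => ?_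
      simp only [hH]
      congr 4
      funext i
      simp only [rootVec, polar, Pi.add_apply]
      push_cast
      ring
    · intro k _
      refine norm_ne_zero_iff.2 (notMem_amoeba_iff.1 hx _ fun i => ?_)
      rw [Pi.add_apply, Complex.add_re, polar_re, rootVec, re_two_pi_mul_div, zero_add]
  have hm : torusMean (fun θ => Real.log ‖eval (cyclicResultant n f) (cexpTorus (polar x θ))‖) =
      n ^ r * ronkin f x := by
    simp_rw [hlog]
    have := torusMean_sum (Finset.univ : Finset (Fin r → Fin n))
      (h := fun k θ => H (θ + fun i => 2 * Real.pi * (k i : ℕ) / n))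
      fun k _ => hHc.comp (continuous_id.add continuous_const)
    rw [this]
    simp_rw [torusMean_comp_add hper]
    rw [ronkin_eq_torusMean]
    simp [hH]
  rw [← hm]
  refine abs_torusMean_sub_le ?_ h
  simp_rw [hlog]
  exact continuous_finsetSum _ fun k _ => hHc.comp (continuous_id.add continuous_const)

/-- The asymptotics of the dominant coefficient of the cyclic resultants. -/
theorem eventually_log_termAbs {f : Laurent r} {x : Space r} (hx : x ∉ amoeba f)
    {v : Fin r → ℤ} (hv : ∀ w : Fin r → ℂ, (∀ i, (w i).re = x i) → index f (cexpTorus w) = v)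
    {ε : ℝ} (hε : 0 < ε) : ∀ᶠ n : ℕ in Filter.atTop,
      (cyclicResultant n f).coeff (n ^ r • v) ≠ 0 ∧
      |Real.log (termAbs (cyclicResultant n f) (n ^ r • v) x) - n ^ r * ronkin f x| ≤ ε := by
  obtain ⟨δ, hδ0, hδ⟩ := exists_strip_of_notMem_amoeba hx
  obtain ⟨A, B, hAB⟩ := exists_support_bounds f
  have hq0 := Real.exp_nonneg (-(δ / 2))
  have hq1 : Real.exp (-(δ / 2)) < 1 := Real.exp_lt_one_iff.2 (by linarith)
  have hlim : Filter.Tendsto (fun n : ℕ => r * ((n : ℝ) ^ r * (3 * |(B : ℝ) - A| *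
      Real.exp (-(δ / 2)) ^ n))) Filter.atTop (nhds 0) := by
    have := (tendsto_pow_const_mul_const_pow_of_lt_one r hq0 hq1).const_mul
      (r * (3 * |(B : ℝ) - A|))
    rw [mul_zero] at this
    refine this.congr fun n => ?_
    ring
  -- `1 / 4` is what `exists_coeff_eq` requires. The final error is `4 * η`: `3 * η` from passing to
  -- the coefficient and `η` from the mean.
  have hη : 0 < min (1 / 4) (ε / 4) := by positivity
  filter_upwards [exists_pow_small (C := 0) hq0 hq1 zero_lt_one,
    hlim.eventually_lt_const hη] with n ⟨hn, hq, _⟩ hsmall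
  set η := r * ((n : ℝ) ^ r * (3 * |(B : ℝ) - A| * Real.exp (-(δ / 2)) ^ n)) with hηdef
  have h1 : η ≤ 1 / 4 := hsmall.le.trans (min_le_left _ _)
  have h2 : 4 * η ≤ ε := by
    have := hsmall.le.trans (min_le_right _ _)
    linarith
  have hpol := exists_cyclicResultant_polar hδ0 hδ hAB hv hn hq
  set g := cyclicResultant n f with hg
  have hg0 : eval g (cexpTorus (polar x 0)) ≠ 0 := by
    rw [hg, eval_cyclicResultant_cexpTorus]
    refine Finset.prod_ne_zero_iff.2 fun k _ => notMem_amoeba_iff.1 hx _ fun i => ?_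
    rw [Pi.add_apply, Complex.add_re, polar_re, rootVec, re_two_pi_mul_div, zero_add]
  obtain ⟨l, hl, hlb⟩ := exists_coeff_eq (g := g) (j := n ^ r • v) (z := cexpTorus (polar x 0))
    h1 (fun θ => by
      obtain ⟨l, e, b⟩ := hpol θ
      refine ⟨l, ?_, b⟩
      have e1 : cexpTorus (fun i => θ i * Complex.I) * cexpTorus (polar x 0) =
          cexpTorus (polar x θ) := by
        rw [← cexpTorus_add]
        congr 1
        funext i
        simp [polar]
        ring
      have e2 : monomialEval (n ^ r • v) 1 (cexpTorus fun i => θ i * Complex.I) =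
          Complex.exp (n ^ r * ∑ i, v i * (θ i * Complex.I)) := by
        simp only [monomialEval, cexpTorus, Units.val_mk0, one_mul, ← Complex.exp_int_mul]
        rw [← Complex.exp_sum, Finset.mul_sum]
        congr 1
        refine Finset.sum_congr rfl fun i _ => ?_
        simp
        ring
      rw [e1, e2, e])
  have hterm := norm_monomialEval g (n ^ r • v) (cexpTorus (polar x 0))
  have hLog : Log (cexpTorus (polar x 0)) = x := by
    ext i
    rw [Log_cexpTorus, polar_re]
  rw [hLog] at hterm
  constructor
  · intro h0
    rw [h0] at hl
    simp only [monomialEval, zero_mul] at hl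
    exact mul_ne_zero hg0 (Complex.exp_ne_zero l) hl.symm
  · have h3 := log_norm_eq_of_eq_mul_exp hg0 hl
    rw [hterm] at h3
    have h4 := abs_log_sub_ronkin_le hx (η := η) fun θ => by
      obtain ⟨l, e, b⟩ := hpol θ
      rw [mul_assoc, ← Complex.exp_add] at e
      rw [log_norm_eq_of_eq_mul_exp hg0 e]
      have : (n ^ r * ∑ i, v i * (θ i * Complex.I) : ℂ) =
          ((n ^ r * ∑ i, v i * θ i : ℝ) : ℂ) * Complex.I := by
        push_cast
        rw [mul_assoc, Finset.sum_mul]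
        simp only [mul_assoc]
      rw [this, add_sub_cancel_left, Complex.add_re, Complex.re_ofReal_mul, Complex.I_re, mul_zero,
        zero_add]
      exact (Complex.abs_re_le_norm l).trans b
    have h5 := (Complex.abs_re_le_norm l).trans hlb
    rw [h3]
    rw [← hg] at h4
    obtain ⟨h4, h4'⟩ := abs_le.1 h4
    obtain ⟨h5, h5'⟩ := abs_le.1 h5
    rw [abs_le]
    constructor <;> linarith

/-! ### Lopsidedness and the index of cyclic resultants -/

theorem norm_eval_sub_le {g : Laurent r} {j : Fin r → ℤ} (hj : j ∈ g.coeff.support) (z : Torus r) :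
    ‖eval g z - monomialEval j (g.coeff j) z‖ ≤
      ∑ l ∈ g.coeff.support.erase j, termAbs g l (Log z) := by
  rw [eval, Finsupp.sum, ← Finset.add_sum_erase _ _ hj, add_sub_cancel_left]
  exact norm_sum_le_of_le _ fun l _ => (norm_monomialEval g l z).le

/-- A lopsided Laurent polynomial has the index of its dominant term. -/
theorem index_eq_of_lopsided {g : Laurent r} {x : Space r} {j : Fin r → ℤ}
    (hj : j ∈ g.coeff.support)
    (hlop : ∑ l ∈ g.coeff.support.erase j, termAbs g l x < termAbs g j x) :
    x ∉ amoeba g ∧ ∀ w : Fin r → ℂ, (∀ i, (w i).re = x i) → index g (cexpTorus w) = j := by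
  -- Homotopy from the dominant term (`t = 0`) to `g` (`t = 1`). The other terms, scaled by `t ≤ 1`,
  -- can never cancel the dominant one, so the index stays constant.
  set G : ℝ → Laurent r := fun t =>
    ((1 - t : ℝ) : ℂ) • AddMonoidAlgebra.single j (g.coeff j) + (t : ℂ) • g with hG
  have hev (t : ℝ) (z : Torus r) : eval (G t) z =
      ((1 - t : ℝ) : ℂ) * monomialEval j (g.coeff j) z + (t : ℂ) * eval g z := by
    rw [hG, ← evalHom_apply, map_add, map_smul, map_smul, evalHom_apply, evalHom_apply, eval_single,
      smul_eq_mul, smul_eq_mul]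
  have hne (t : ℝ) (ht : t ∈ Set.Icc (0 : ℝ) 1) (w : Fin r → ℂ) (hw : ∀ i, (w i).re = x i) :
      eval (G t) (cexpTorus w) ≠ 0 := by
    intro h0
    have hx : Log (cexpTorus w) = x := by
      ext i
      rw [Log_cexpTorus, hw]
    have h1 := norm_eval_sub_le hj (cexpTorus w)
    have h2 := norm_monomialEval g j (cexpTorus w)
    rw [hx] at h1 h2
    rw [hev] at h0
    have h3 : monomialEval j (g.coeff j) (cexpTorus w) =
        -((t : ℂ) * (eval g (cexpTorus w) - monomialEval j (g.coeff j) (cexpTorus w))) := by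
      push_cast at h0
      linear_combination h0
    have h4 := congrArg norm h3
    rw [norm_neg, norm_mul, Complex.norm_real, Real.norm_eq_abs, abs_of_nonneg ht.1, h2] at h4
    have h5 := norm_nonneg (eval g (cexpTorus w) - monomialEval j (g.coeff j) (cexpTorus w))
    have h6 := ht.2
    nlinarith
  have hG1 : G 1 = g := by simp [hG]
  have hG0 : G 0 = AddMonoidAlgebra.single j (g.coeff j) := by simp [hG]
  refine ⟨notMem_amoeba_iff.2 fun w hw => hG1 ▸ hne 1 (by simp) w hw, fun w hw => ?_⟩
  funext i
  obtain ⟨A, B, hAB⟩ := exists_support_bounds g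
  have hsupp (t : ℝ) : (G t).coeff.support ⊆ g.coeff.support := by
    intro l hl
    by_contra h
    have hlj : l ≠ j := fun e => h (e ▸ hj)
    rw [Finsupp.mem_support_iff] at hl
    refine hl ?_
    simp [hG, Finsupp.notMem_support_iff.1 h, hlj]
  have hcont : Continuous fun p : ℝ × ℂ => eval (G p.1) (cexpTorus (w + Pi.single i p.2)) := by
    simp_rw [hev, ← eval_single]
    have hs : Continuous fun p : ℝ × ℂ => w + Pi.single i p.2 :=
      continuous_const.add ((continuous_single i).comp continuous_snd)
    refine Continuous.add (Continuous.mul ?_ ((continuous_eval_cexpTorus _).comp hs))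
      (Continuous.mul ?_ ((continuous_eval_cexpTorus _).comp hs))
    · fun_prop
    · fun_prop
  have hc : ContinuousOn (fun t => index (G t) (cexpTorus w) i) (Set.Icc 0 1) := by
    intro t ht
    have h := eventually_index_eq (f := G) (w := fun _ => w) (τ₀ := t) hcont
      (fun t l hl => (hAB l (hsupp t hl) i).1) (fun t l hl => (hAB l (hsupp t hl) i).2)
      (fun φ => hne t ht _ fun l => by
        rcases eq_or_ne l i with rfl | hl
        · simp [hw]
        · simp [hw, hl])
    exact (continuousAt_const.congr (h.mono fun _ h => h.symm)).continuousWithinAt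
  have h := isPreconnected_Icc.constant hc (x := 1) (y := 0) (by simp) (by simp)
  rwa [hG1, hG0, index_single (Finsupp.mem_support_iff.1 hj)] at h

theorem notMem_amoeba_of_cyclicResultant {f : Laurent r} {n : ℕ} (hn : 0 < n) {x : Space r}
    (hx : x ∉ amoeba (cyclicResultant n f)) : x ∉ amoeba f := by
  have : NeZero n := ⟨hn.ne'⟩
  refine notMem_amoeba_iff.2 fun w hw h0 => notMem_amoeba_iff.1 hx w hw ?_
  rw [eval_cyclicResultant_cexpTorus]
  refine Finset.prod_eq_zero (Finset.mem_univ 0) ?_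
  convert h0
  funext i
  simp [rootVec]

theorem notMem_amoeba_cyclicResultant {f : Laurent r} (n : ℕ) {x : Space r}
    (hx : x ∉ amoeba f) : x ∉ amoeba (cyclicResultant n f) := by
  refine notMem_amoeba_iff.2 fun w hw => ?_
  rw [eval_cyclicResultant_cexpTorus]
  refine Finset.prod_ne_zero_iff.2 fun k _ => notMem_amoeba_iff.1 hx _ fun i => ?_
  rw [Pi.add_apply, Complex.add_re, hw, rootVec, re_two_pi_mul_div, zero_add]

/-- The index of the cyclic resultant. -/
theorem index_cyclicResultant {f : Laurent r} {x : Space r} (hx : x ∉ amoeba f) {n : ℕ}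
    {v v' : Fin r → ℤ}
    (hv : ∀ w : Fin r → ℂ, (∀ i, (w i).re = x i) → index f (cexpTorus w) = v)
    (hv' : ∀ w : Fin r → ℂ, (∀ i, (w i).re = x i) →
      index (cyclicResultant n f) (cexpTorus w) = v') : v' = n ^ r • v := by
  funext i
  set g := cyclicResultant n f with hg
  obtain ⟨δ₁, h1, hδ₁⟩ := exists_strip_of_notMem_amoeba hx
  obtain ⟨δ₂, h2, hδ₂⟩ := exists_strip_of_notMem_amoeba (notMem_amoeba_cyclicResultant n hx)
  set δ := min δ₁ δ₂ with hδdef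
  have hδ0 : 0 < δ := lt_min h1 h2
  obtain ⟨A, B, hAB⟩ := exists_support_bounds f
  obtain ⟨A', B', hAB'⟩ := exists_support_bounds g
  -- Here `n` is fixed and `m` is an auxiliary number of rotations that measures both indices. The
  -- constant is the sum of the errors of `g` and of its `n ^ r` factors; a total below `δ / 2`
  -- forces an integer multiple of `m` to vanish.
  obtain ⟨m, hm, hq, hC⟩ := (exists_pow_small (q := Real.exp (-(δ / 2)))
    (C := n ^ r * (3 * (B - A)) + 3 * (B' - A'))
    (ε := δ / 2) (Real.exp_nonneg _) (Real.exp_lt_one_iff.2 (by linarith)) (by linarith)).exists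
  have hm1 : (1 : ℝ) ≤ m := by exact_mod_cast hm
  have hre0 (i : Fin r) : (polar x 0 i).re = x i := polar_re x 0 i
  have hrek (k : Fin r → Fin n) (i : Fin r) : ((rootVec n k + polar x 0) i).re = x i := by
    rw [Pi.add_apply, Complex.add_re, hre0, rootVec, re_two_pi_mul_div, zero_add]
  have hgb := abs_log_prod_shift_le hδ0
    (fun s hs => hδ₂ i _ hre0 s (hs.trans (min_le_right _ _)))
    (fun j hj => (hAB' j hj i).1) (fun j hj => (hAB' j hj i).2) hm hq
  have hfb (k : Fin r → Fin n) := abs_log_prod_shift_le hδ0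
    (fun s hs => hδ₁ i _ (hrek k) s (hs.trans (min_le_left _ _)))
    (fun j hj => (hAB j hj i).1) (fun j hj => (hAB j hj i).2) hm hq
  have hsplit (s : Fin m → ℂ) (hs : ∀ l, |(s l).re| ≤ δ) :
      Real.log ‖∏ l, eval g (cexpTorus (polar x 0 + Pi.single i (s l)))‖ =
      ∑ k : Fin r → Fin n,
        Real.log ‖∏ l, eval f (cexpTorus (rootVec n k + polar x 0 + Pi.single i (s l)))‖ := by
    rw [← Real.log_prod, ← norm_prod, Finset.prod_comm]
    · simp_rw [hg, eval_cyclicResultant_cexpTorus, add_assoc]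
    · intro k _
      exact norm_ne_zero_iff.2 (Finset.prod_ne_zero_iff.2 fun l _ =>
        hδ₁ i _ (hrek k) _ ((hs l).trans (min_le_left _ _)))
  rw [hsplit _ fun l => by rw [Complex.add_re, re_two_pi_mul_div, add_zero, Complex.ofReal_re,
      abs_of_pos (by positivity)]; linarith,
    hsplit _ fun l => by rw [re_two_pi_mul_div, abs_zero]; exact hδ0.le, hv' _ hre0] at hgb
  have hsum := Finset.abs_sum_le_sum_abs (fun k : Fin r → Fin n => _) Finset.univ |>.trans
    (Finset.sum_le_sum fun k (_ : k ∈ Finset.univ) => hfb k)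
  simp only [hv _ (hrek _), Finset.sum_sub_distrib, Finset.sum_const, Finset.card_univ,
    Fintype.card_pi, Fintype.card_fin, Finset.prod_const, nsmul_eq_mul] at hsum
  rw [Nat.cast_pow] at hsum
  obtain ⟨e1, e1'⟩ := abs_le.1 hgb
  obtain ⟨e0, e0'⟩ := abs_le.1 hsum
  have h3 : (m : ℝ) * v' i * (δ / 2) - n ^ r * (m * v i * (δ / 2)) < δ / 2 := by linarith
  have h4 : -(δ / 2) < (m : ℝ) * v' i * (δ / 2) - n ^ r * (m * v i * (δ / 2)) := by linarith
  have h5 : m * ((v' i : ℝ) - n ^ r * v i) < 1 := by nlinarith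
  have h6 : -1 < m * ((v' i : ℝ) - n ^ r * v i) := by nlinarith
  have h7 : (m : ℤ) * (v' i - n ^ r * v i) = 0 := by
    have h5' : (m : ℤ) * (v' i - n ^ r * v i) < 1 := by exact_mod_cast h5
    have h6' : -1 < (m : ℤ) * (v' i - n ^ r * v i) := by exact_mod_cast h6
    omega
  rcases mul_eq_zero.1 h7 with h8 | h8
  · omega
  · simp only [Pi.smul_apply, nsmul_eq_mul]
    push_cast
    linarith

/-! ### Maxima of finitely many affine functions -/

section MaxAffine

variable {V : Type*} [NormedAddCommGroup V] [InnerProductSpace ℝ V] {ι : Type*}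

/-- The maximum of the affine functions `a i + ⟪u i, ·⟫`. -/
def maxAffine (a : ι → ℝ) (u : ι → V) (x : V) : ℝ := ⨆ i, (a i + inner ℝ (u i) x)

variable {a b : ι → ℝ} {u : ι → V} {x : V}

theorem le_maxAffine [Finite ι] (i : ι) (x : V) : a i + inner ℝ (u i) x ≤ maxAffine a u x :=
  le_ciSup (f := fun i => a i + inner ℝ (u i) x) (Set.finite_range _).bddAbove i

theorem maxAffine_eq_of_forall_le {i : ι}
    (h : ∀ j, a j + inner ℝ (u j) x ≤ a i + inner ℝ (u i) x) :
    maxAffine a u x = a i + inner ℝ (u i) x :=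
  le_antisymm (@ciSup_le _ _ _ ⟨i⟩ _ _ h)
    (le_ciSup (f := fun i => a i + inner ℝ (u i) x) ⟨_, Set.forall_mem_range.2 h⟩ i)

theorem exists_maxAffine_eq [Finite ι] [Nonempty ι] (a : ι → ℝ) (u : ι → V) (x : V) :
    ∃ i, maxAffine a u x = a i + inner ℝ (u i) x := by
  obtain ⟨i, hi⟩ := Finite.exists_max fun i => a i + inner ℝ (u i) x
  exact ⟨i, maxAffine_eq_of_forall_le hi⟩

/-- Active pieces of equal slope coincide, since they agree at `x`; the inactive ones stay strictly
below near `x`. -/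
theorem eventually_maxAffine_eq [Finite ι] {i : ι}
    (hi : maxAffine a u x = a i + inner ℝ (u i) x)
    (h : ∀ j, maxAffine a u x = a j + inner ℝ (u j) x → u j = u i) :
    ∀ᶠ y in nhds x, maxAffine a u y = a i + inner ℝ (u i) y := by
  have h1 : ∀ j, ∀ᶠ y in nhds x, a j + inner ℝ (u j) y ≤ a i + inner ℝ (u i) y := by
    intro j
    rcases (le_maxAffine (a := a) (u := u) j x).eq_or_lt with hj | hj
    · have hu := h j hj.symm
      have : a j = a i := by
        rw [hi, hu] at hj
        linarith
      exact Filter.Eventually.of_forall fun y => by rw [hu, this]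
    · rw [hi] at hj
      have hc1 : ContinuousAt (fun y => a j + inner ℝ (u j) y) x := by fun_prop
      have hc2 : ContinuousAt (fun y => a i + inner ℝ (u i) y) x := by fun_prop
      exact (hc1.eventually_lt hc2 hj).mono fun y hy => hy.le
  exact (Filter.eventually_all.2 h1).mono fun y hy => maxAffine_eq_of_forall_le hy

/-- The maximum minus an active piece has a minimum at `x`, so its derivative vanishes there. -/
theorem slope_eq_of_differentiableAt [Finite ι] (hd : DifferentiableAt ℝ (maxAffine a u) x)
    {i : ι} (hi : maxAffine a u x = a i + inner ℝ (u i) x) :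
    fderiv ℝ (maxAffine a u) x = innerSL ℝ (u i) := by
  have h1 : HasFDerivAt (fun y => a i + inner ℝ (u i) y) (innerSL ℝ (u i)) x :=
    ((innerSL ℝ (u i)).hasFDerivAt (x := x)).const_add (a i)
  have h2 : IsLocalMin (fun y => maxAffine a u y - (a i + inner ℝ (u i) y)) x :=
    Filter.Eventually.of_forall fun y => by
      simp only
      rw [hi, sub_self]
      linarith [le_maxAffine (a := a) (u := u) i y]
  exact sub_eq_zero.1 (h2.hasFDerivAt_eq_zero (hd.hasFDerivAt.sub h1))

theorem slope_eq_slope_of_differentiableAt [Finite ι]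
    (hd : DifferentiableAt ℝ (maxAffine a u) x) {i j : ι}
    (hi : maxAffine a u x = a i + inner ℝ (u i) x)
    (hj : maxAffine a u x = a j + inner ℝ (u j) x) : u j = u i := by
  have h := (slope_eq_of_differentiableAt hd hj).symm.trans (slope_eq_of_differentiableAt hd hi)
  exact ext_inner_right ℝ fun y => by simpa using DFunLike.congr_fun h y

theorem eventually_maxAffine_eq_of_differentiableAt [Finite ι]
    (hd : DifferentiableAt ℝ (maxAffine a u) x) {i : ι}
    (hi : maxAffine a u x = a i + inner ℝ (u i) x) :
    ∀ᶠ y in nhds x, maxAffine a u y = a i + inner ℝ (u i) y :=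
  eventually_maxAffine_eq hi fun _ hj => slope_eq_slope_of_differentiableAt hd hi hj

theorem contDiffAt_maxAffine [Finite ι] {i : ι} {n : WithTop ℕ∞}
    (hi : maxAffine a u x = a i + inner ℝ (u i) x)
    (h : ∀ j, maxAffine a u x = a j + inner ℝ (u j) x → u j = u i) :
    ContDiffAt ℝ n (maxAffine a u) x := by
  have h1 : ContDiffAt ℝ n (fun y => a i + inner ℝ (u i) y) x :=
    contDiffAt_const.add (innerSL ℝ (u i)).contDiff.contDiffAt
  exact h1.congr_of_eventuallyEq (eventually_maxAffine_eq hi h)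

theorem maxAffine_of_isEmpty [IsEmpty ι] : maxAffine a u = fun _ => 0 := by
  funext x
  simp [maxAffine]

/-- Differentiability already makes the maximum locally affine. This reconciles the two spines, one
defined by smoothness and the other by differentiability. -/
theorem contDiffAt_maxAffine_iff [Finite ι] {n : WithTop ℕ∞} (hn : n ≠ 0) :
    ContDiffAt ℝ n (maxAffine a u) x ↔ DifferentiableAt ℝ (maxAffine a u) x := by
  refine ⟨fun h => h.differentiableAt hn, fun hd => ?_⟩
  rcases isEmpty_or_nonempty ι with hι | hι
  · rw [maxAffine_of_isEmpty]
    exact contDiffAt_const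
  · obtain ⟨i, hi⟩ := exists_maxAffine_eq a u x
    exact contDiffAt_maxAffine hi fun j hj => slope_eq_slope_of_differentiableAt hd hi hj

/-- The set of agreement with the piece is open and relatively closed in the connected ball. -/
theorem maxAffine_eqOn_ball [Finite ι] {ε : ℝ} (hε : 0 < ε)
    (hd : ∀ y ∈ Metric.ball x ε, DifferentiableAt ℝ (maxAffine a u) y) {i : ι}
    (hi : maxAffine a u x = a i + inner ℝ (u i) x) :
    ∀ y ∈ Metric.ball x ε, maxAffine a u y = a i + inner ℝ (u i) y := by
  set Z := {y ∈ Metric.ball x ε | maxAffine a u y = a i + inner ℝ (u i) y} with hZ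
  have hZo : IsOpen Z := by
    rw [isOpen_iff_mem_nhds]
    rintro y ⟨hy, hy'⟩
    exact Filter.Eventually.and (Metric.isOpen_ball.mem_nhds hy)
      (eventually_maxAffine_eq_of_differentiableAt (hd y hy) hy')
  have hsub := (convex_ball x ε).isPreconnected.subset_of_closure_inter_subset hZo
    ⟨x, Metric.mem_ball_self hε, Metric.mem_ball_self hε, hi⟩ (by
      rintro y ⟨hy, hyb⟩
      refine ⟨hyb, ?_⟩
      by_contra hne
      have hc : ContinuousAt (fun z => maxAffine a u z - (a i + inner ℝ (u i) z)) y :=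
        (hd y hyb).continuousAt.sub (by fun_prop)
      have h1 := hc.eventually_ne (sub_ne_zero.2 hne)
      obtain ⟨z, hz, hz'⟩ := ((mem_closure_iff_frequently.1 hy).and_eventually h1).exists
      exact hz' (sub_eq_zero.2 hz.2))
  exact fun y hy => (hsub hy).2

/-- The corner loci of two maxima of affine functions with the same, well separated, slopes are
close when the constant terms are. -/
theorem exists_not_differentiableAt [Finite ι] {δ ε : ℝ} (hδ : 2 * δ < ε)
    (hab : ∀ i, |a i - b i| ≤ δ) (hu : ∀ i j, u i ≠ u j → 1 ≤ ‖u i - u j‖)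
    (hx : ¬ DifferentiableAt ℝ (maxAffine a u) x) :
    ∃ y ∈ Metric.ball x ε, ¬ DifferentiableAt ℝ (maxAffine b u) y := by
  rcases isEmpty_or_nonempty ι with hι | hι
  · rw [maxAffine_of_isEmpty] at hx
    exact absurd (differentiableAt_const _) hx
  have hδ0 : 0 ≤ δ := (abs_nonneg _).trans (hab hι.some)
  by_contra! h
  obtain ⟨k, hk⟩ := exists_maxAffine_eq b u x
  have hball := maxAffine_eqOn_ball (by linarith) h hk
  -- If every piece active for `a` at `x` had the slope `u k`, then `maxAffine a u` would be
  -- differentiable there.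
  obtain ⟨i, hi, hik⟩ : ∃ i, maxAffine a u x = a i + inner ℝ (u i) x ∧ u i ≠ u k := by
    by_contra! h'
    obtain ⟨i, hi⟩ := exists_maxAffine_eq a u x
    refine hx ((contDiffAt_maxAffine (n := 1) hi fun j hj => ?_).differentiableAt one_ne_zero)
    rw [h' j hj, h' i hi]
  -- Any `t` strictly between `2 * δ` and `ε` works. At `x` piece `i` of `b` lags behind piece `k`
  -- by at most `2 * δ`; a step of length `t` along `u i - u k` gains at least `t`, so `k` no longer
  -- attains the maximum inside the ball.
  set t := (2 * δ + ε) / 2 with ht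
  have ht0 : 0 ≤ t := by linarith
  set d := u i - u k with hd
  have hd1 : 1 ≤ ‖d‖ := hu i k hik
  set y := x + (t / ‖d‖) • d with hy
  have hyb : y ∈ Metric.ball x ε := by
    rw [Metric.mem_ball, hy, dist_self_add_left, norm_smul, Real.norm_eq_abs, abs_of_nonneg
      (by positivity), div_mul_cancel₀ _ (by positivity)]
    linarith
  have h1 := (le_maxAffine (a := b) (u := u) i y).trans_eq (hball y hyb)
  have h2 := (le_maxAffine (a := a) (u := u) k x).trans_eq hi
  have h3 : inner ℝ d y = inner ℝ d x + t * ‖d‖ := by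
    rw [hy, inner_add_right, inner_smul_right, real_inner_self_eq_norm_mul_norm]
    field_simp
  have h4 : inner ℝ d y = inner ℝ (u i) y - inner ℝ (u k) y := inner_sub_left _ _ _
  have h5 : inner ℝ d x = inner ℝ (u i) x - inner ℝ (u k) x := inner_sub_left _ _ _
  have h6 := abs_le.1 (hab i)
  have h7 := abs_le.1 (hab k)
  have h8 : t ≤ t * ‖d‖ := le_mul_of_one_le_right (by linarith) hd1
  linarith [h6.1, h6.2, h7.1, h7.2]

end MaxAffine

/-! ### Both maxima as maxima over the index vectors -/

/-- An exponent vector as a vector of `ℝ^r`. -/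
def slope (v : Fin r → ℤ) : Space r := WithLp.toLp 2 fun i => (v i : ℝ)

theorem inner_slope (v : Fin r → ℤ) (x : Space r) : inner ℝ (slope v) x = ∑ i, (v i : ℝ) * x i := by
  simp [slope, PiLp.inner_apply, mul_comm]

theorem one_le_norm_smul_slope_sub {v v' : Fin r → ℤ} {c : ℝ} (hc : 1 ≤ c)
    (h : c • slope v ≠ c • slope v') : 1 ≤ ‖c • slope v - c • slope v'‖ := by
  have hv : v ≠ v' := fun e => h (by rw [e])
  obtain ⟨i, hi⟩ := Function.ne_iff.1 hv
  rw [← smul_sub, norm_smul, Real.norm_eq_abs, abs_of_nonneg (by linarith)]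
  have h1 : ‖(slope v - slope v') i‖ ≤ ‖slope v - slope v'‖ := PiLp.norm_apply_le _ i
  have h2 : (slope v - slope v') i = ((v i - v' i : ℤ) : ℝ) := by
    simp [slope]
  have h3 : (1 : ℝ) ≤ |((v i - v' i : ℤ) : ℝ)| := by
    exact_mod_cast Int.one_le_abs (sub_ne_zero.2 hi)
  rw [h2, Real.norm_eq_abs] at h1
  nlinarith

theorem log_termAbs {g : Laurent r} {n : ℕ} {v : Fin r → ℤ} (h : g.coeff (n ^ r • v) ≠ 0)
    (x : Space r) : Real.log (termAbs g (n ^ r • v) x) =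
      Real.log ‖g.coeff (n ^ r • v)‖ + inner ℝ ((n : ℝ) ^ r • slope v) x := by
  rw [termAbs, Real.log_mul (norm_ne_zero_iff.2 h) (Real.exp_ne_zero _), Real.log_exp,
    inner_smul_left, inner_slope, Finset.mul_sum]
  congr 1
  refine Finset.sum_congr rfl fun i _ => ?_
  simp
  ring

theorem componentIndex_eq_of_mem {f : Laurent r} (E : complementComponents f) {x : Space r}
    (hx : x ∈ E.1) : x ∉ amoeba f ∧
      ∀ w : Fin r → ℂ, (∀ i, (w i).re = x i) → index f (cexpTorus w) = componentIndex f E := by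
  refine ⟨?_, fun w hw => componentIndex_eq E hx hw⟩
  obtain ⟨a, -, h2⟩ := E.2
  exact connectedComponentIn_subset (amoeba f)ᶜ a (h2 ▸ hx)

theorem exists_mem_component {f : Laurent r} (E : complementComponents f) : ∃ x, x ∈ E.1 := by
  obtain ⟨a, h1, h2⟩ := E.2
  exact ⟨a, h2 ▸ mem_connectedComponentIn h1⟩

theorem finite_range_componentIndex (f : Laurent r) : (Set.range (componentIndex f)).Finite := by
  obtain ⟨A, B, hAB⟩ := exists_support_bounds f
  refine (Set.finite_Icc (fun _ : Fin r => A) fun _ => B).subset ?_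
  rintro _ ⟨E, rfl⟩
  obtain ⟨x, hx⟩ := exists_mem_component E
  obtain ⟨h1, h2⟩ := componentIndex_eq_of_mem E hx
  have h3 (i : Fin r) := index_mem_Icc (notMem_amoeba_iff.1 h1 _ (polar_re x 0))
    (fun j hj => (hAB j hj i).1) (fun j hj => (hAB j hj i).2)
  rw [h2 _ (polar_re x 0)] at h3
  exact ⟨fun i => (h3 i).1, fun i => (h3 i).2⟩

/-- Part of the Ronkin function determined by the index. -/
theorem ronkin_sub_eq {f : Laurent r} {x y : Space r} (hx : x ∉ amoeba f) (hy : y ∉ amoeba f)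
    {v : Fin r → ℤ} (hvx : ∀ w : Fin r → ℂ, (∀ i, (w i).re = x i) → index f (cexpTorus w) = v)
    (hvy : ∀ w : Fin r → ℂ, (∀ i, (w i).re = y i) → index f (cexpTorus w) = v) :
    ronkin f x - inner ℝ (slope v) x = ronkin f y - inner ℝ (slope v) y := by
  refine eq_of_abs_sub_le_all fun ε hε => ?_
  -- The same coefficient of `f_n` occurs at `x` and at `y`, and cancels in the comparison.
  obtain ⟨n, ⟨h0, h1⟩, ⟨-, h2⟩, hn⟩ := ((eventually_log_termAbs hx hvx (half_pos hε)).and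
    ((eventually_log_termAbs hy hvy (half_pos hε)).and (Filter.eventually_gt_atTop 0))).exists
  rw [log_termAbs h0, inner_smul_left] at h1 h2
  simp only [conj_trivial] at h1 h2
  have hn1 : (1 : ℝ) ≤ (n : ℝ) ^ r := one_le_pow₀ (by exact_mod_cast hn)
  set c := (n : ℝ) ^ r
  obtain ⟨h1, h1'⟩ := abs_le.1 h1
  obtain ⟨h2, h2'⟩ := abs_le.1 h2
  set d := ronkin f x - inner ℝ (slope v) x - (ronkin f y - inner ℝ (slope v) y) with hd
  have h3 : |c * d| ≤ ε := by
    rw [abs_le, hd]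
    constructor <;> linarith
  rw [abs_mul, abs_of_nonneg (by linarith : (0 : ℝ) ≤ c)] at h3
  nlinarith [abs_nonneg d]

theorem affineMap_eq_of_eqOn {A A' : Space r →ᵃ[ℝ] ℝ} {U : Set (Space r)} (hU : IsOpen U)
    {x : Space r} (hx : x ∈ U) (h : Set.EqOn A A' U) : A = A' := by
  ext z
  have hc : ContinuousAt (fun t : ℝ => AffineMap.lineMap x z t) 0 := by
    simp only [AffineMap.lineMap_apply, vsub_eq_sub, vadd_eq_add]
    fun_prop
  have hev : ∀ᶠ t in nhds (0 : ℝ), AffineMap.lineMap x z t ∈ U :=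
    hc.eventually_mem (hU.mem_nhds (by simpa using hx))
  obtain ⟨ε, hε, hball⟩ := Metric.eventually_nhds_iff.1 hev
  have h1 := h (hball (y := ε / 2) (by rw [Real.dist_0_eq_abs, abs_of_pos] <;> linarith))
  have h2 := h hx
  rw [AffineMap.apply_lineMap, AffineMap.apply_lineMap, h2] at h1
  simp only [AffineMap.lineMap_apply, vsub_eq_sub, vadd_eq_add, smul_eq_mul] at h1
  have h3 : ε / 2 ≠ 0 := by positivity
  have h4 := mul_left_cancel₀ h3 (add_right_cancel h1)
  linarith

theorem isOpen_component {f : Laurent r} (E : complementComponents f) : IsOpen E.1 := by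
  obtain ⟨a, -, h2⟩ := E.2
  rw [h2]
  exact (isOpen_compl_amoeba f).connectedComponentIn

/-- The point `x` need not lie in `E`: any point of the same index determines the same affine
function. Uniqueness holds because `E` is open and nonempty. -/
theorem affineExtension_apply {f : Laurent r} (E : complementComponents f) {x : Space r}
    {v : Fin r → ℤ} (hx : x ∉ amoeba f)
    (hv : ∀ w : Fin r → ℂ, (∀ i, (w i).re = x i) → index f (cexpTorus w) = v)
    (hE : componentIndex f E = v) (y : Space r) :
    affineExtension f E y = ronkin f x - inner ℝ (slope v) x + inner ℝ (slope v) y := by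
  set A : Space r →ᵃ[ℝ] ℝ := (innerSL ℝ (slope v)).toLinearMap.toAffineMap +
    AffineMap.const ℝ _ (ronkin f x - inner ℝ (slope v) x) with hA
  have hAy (y : Space r) : A y = ronkin f x - inner ℝ (slope v) x + inner ℝ (slope v) y := by
    simp [hA]
    ring
  have hon : Set.EqOn A (ronkin f) E.1 := by
    intro z hz
    obtain ⟨h1, h2⟩ := componentIndex_eq_of_mem E hz
    have := ronkin_sub_eq hx h1 hv (hE ▸ h2)
    rw [hAy, this]
    ring
  have hex : ∃ A : Space r →ᵃ[ℝ] ℝ, Set.EqOn A (ronkin f) E.1 := ⟨A, hon⟩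
  obtain ⟨z, hz⟩ := exists_mem_component E
  rw [← hAy, affineExtension, dif_pos hex]
  exact congrArg (fun A : Space r →ᵃ[ℝ] ℝ => A y) (affineMap_eq_of_eqOn (isOpen_component E) hz
    fun w hw => (hex.choose_spec hw).trans (hon hw).symm)

/-- Indexing by index vectors makes the family finite, so the coefficient estimates hold for all of
them simultaneously once `n` is large. -/
theorem exists_ronkinMax_eq (f : Laurent r) : ∃ α : Set.range (componentIndex f) → ℝ,
    (ronkinMax f = maxAffine α fun v => slope v.1) ∧
    ∀ ε > 0, ∀ᶠ n : ℕ in Filter.atTop, ∀ v : Set.range (componentIndex f),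
      (cyclicResultant n f).coeff (n ^ r • v.1) ≠ 0 ∧
      |Real.log ‖(cyclicResultant n f).coeff (n ^ r • v.1)‖ - n ^ r * α v| ≤ ε := by
  choose E hE using fun v : Set.range (componentIndex f) => v.2
  choose x hx using fun v => exists_mem_component (E v)
  have hxv (v) := componentIndex_eq_of_mem (E v) (hx v)
  refine ⟨fun v => ronkin f (x v) - inner ℝ (slope v.1) (x v), ?_, fun ε hε => ?_⟩
  · funext y
    rw [ronkinMax, maxAffine, ← (Set.rangeFactorization_surjective
      (f := componentIndex f)).iSup_comp]
    refine iSup_congr fun E' => ?_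
    exact affineExtension_apply E' (hxv _).1 (fun w hw => ((hxv _).2 w hw).trans (hE _)) rfl y
  · have := (finite_range_componentIndex f).to_subtype
    refine Filter.eventually_all.2 fun v => ?_
    filter_upwards [eventually_log_termAbs (hxv v).1
      (fun w hw => ((hxv v).2 w hw).trans (hE v)) hε] with n hn
    refine ⟨hn.1, ?_⟩
    have h1 := hn.2
    rw [log_termAbs hn.1, inner_smul_left, conj_trivial] at h1
    convert h1 using 2
    ring

theorem approxMax_eq (f : Laurent r) (n : ℕ) : approxMax f n =
    maxAffine (fun v : {v : Set.range (componentIndex f) //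
        (cyclicResultant n f).coeff (n ^ r • v.1) ≠ 0} =>
          Real.log ‖(cyclicResultant n f).coeff (n ^ r • v.1.1)‖)
      fun v => (n : ℝ) ^ r • slope v.1.1 := by
  funext y
  have hs : Function.Surjective (fun E : {E : complementComponents f //
      (cyclicResultant n f).coeff (dominantExponent f n E) ≠ 0} =>
      (⟨⟨componentIndex f E.1, E.1, rfl⟩, E.2⟩ : {v : Set.range (componentIndex f) //
        (cyclicResultant n f).coeff (n ^ r • v.1) ≠ 0})) := by
    rintro ⟨⟨_, E, rfl⟩, h⟩
    exact ⟨⟨E, h⟩, rfl⟩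
  rw [approxMax, maxAffine, ← hs.iSup_comp]
  refine iSup_congr fun E => ?_
  exact log_termAbs E.2 y

theorem approxMax_eq_of_forall_ne_zero {f : Laurent r} {n : ℕ}
    (h : ∀ v : Set.range (componentIndex f), (cyclicResultant n f).coeff (n ^ r • v.1) ≠ 0) :
    approxMax f n = maxAffine (fun v : Set.range (componentIndex f) =>
          Real.log ‖(cyclicResultant n f).coeff (n ^ r • v.1)‖)
      fun v => (n : ℝ) ^ r • slope v.1 := by
  funext y
  rw [approxMax_eq, maxAffine, maxAffine]
  exact (Equiv.subtypeUnivEquiv h).surjective.iSup_comp (g := fun v =>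
    Real.log ‖(cyclicResultant n f).coeff (n ^ r • v.1)‖ + inner ℝ ((n : ℝ) ^ r • slope v.1) y)

/-! ### The inclusion and the Hausdorff limit -/

theorem termAbs_nonneg (g : Laurent r) (j : Fin r → ℤ) (x : Space r) : 0 ≤ termAbs g j x :=
  mul_nonneg (norm_nonneg _) (Real.exp_nonneg _)

theorem approxSpine_subset_lopsidedAmoeba (f : Laurent r) {n : ℕ} (hn : 0 < n) :
    approxSpine f n ⊆ lopsidedAmoeba (cyclicResultant n f) := by
  rintro x hx ⟨j, hj, hlop⟩
  obtain ⟨hxg, hidx⟩ := index_eq_of_lopsided hj hlop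
  have hxf := notMem_amoeba_of_cyclicResultant hn hxg
  set E : complementComponents f := ⟨_, x, hxf, rfl⟩ with hE
  have hxE : x ∈ E.1 := mem_connectedComponentIn hxf
  have hv := (componentIndex_eq_of_mem E hxE).2
  have hjv : j = n ^ r • componentIndex f E := index_cyclicResultant hxf hv hidx
  have hc : (cyclicResultant n f).coeff (n ^ r • componentIndex f E) ≠ 0 :=
    hjv ▸ Finsupp.mem_support_iff.1 hj
  have := (finite_range_componentIndex f).to_subtype
  set i : {v : Set.range (componentIndex f) //
        (cyclicResultant n f).coeff (n ^ r • v.1) ≠ 0} := ⟨⟨componentIndex f E, E, rfl⟩, hc⟩ with hi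
  -- Every other candidate is one of the terms whose sum the dominant term exceeds.
  have hlt (k : {v : Set.range (componentIndex f) //
        (cyclicResultant n f).coeff (n ^ r • v.1) ≠ 0}) (hk : k.1.1 ≠ componentIndex f E) :
      Real.log (termAbs (cyclicResultant n f) (n ^ r • k.1.1) x) <
        Real.log (termAbs (cyclicResultant n f) (n ^ r • i.1.1) x) := by
    have hpos : 0 < termAbs (cyclicResultant n f) (n ^ r • k.1.1) x :=
      mul_pos (norm_pos_iff.2 k.2) (Real.exp_pos _)
    refine Real.log_lt_log hpos ?_
    have hne : n ^ r • k.1.1 ≠ j := by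
      rw [hjv]
      intro h
      exact hk (smul_right_injective _ (pow_ne_zero r hn.ne') h)
    refine lt_of_le_of_lt ?_ (hjv ▸ hlop)
    rw [← hjv]
    exact Finset.single_le_sum (f := fun l => termAbs (cyclicResultant n f) l x)
      (fun l _ => termAbs_nonneg _ l x)
      (Finset.mem_erase.2 ⟨hne, Finsupp.mem_support_iff.2 k.2⟩)
  simp_rw [fun k : {v : Set.range (componentIndex f) //
    (cyclicResultant n f).coeff (n ^ r • v.1) ≠ 0} => log_termAbs k.2 x] at hlt
  refine hx ?_
  rw [approxMax_eq]
  have hmax := maxAffine_eq_of_forall_le (a := fun v : {v : Set.range (componentIndex f) //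
        (cyclicResultant n f).coeff (n ^ r • v.1) ≠ 0} =>
          Real.log ‖(cyclicResultant n f).coeff (n ^ r • v.1.1)‖)
      (u := fun v => (n : ℝ) ^ r • slope v.1.1) (x := x) (i := i) fun k => by
    by_cases hk : k.1.1 = componentIndex f E
    · rw [show k = i from Subtype.ext (Subtype.ext hk)]
    · exact (hlt k hk).le
  refine contDiffAt_maxAffine hmax fun k hk => ?_
  by_contra hne
  have hk' : k.1.1 ≠ componentIndex f E := fun h => hne (by
    rw [show k = i from Subtype.ext (Subtype.ext h)])
  exact (hlt k hk').ne (hk.symm.trans hmax)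

theorem tendsto_hausdorffEDist_approxSpine (f : Laurent r) :
    Filter.Tendsto (fun n : ℕ => Metric.hausdorffEDist (approxSpine f n) (spine f))
      Filter.atTop (nhds 0) := by
  obtain ⟨α, hα, hlim⟩ := exists_ronkinMax_eq f
  have := (finite_range_componentIndex f).to_subtype
  rw [ENNReal.tendsto_nhds_zero]
  intro ε hε
  obtain ⟨ε', hε', hle⟩ : ∃ ε' : ℝ, 0 < ε' ∧ ENNReal.ofReal ε' ≤ ε := by
    obtain ⟨q, hq, hqε⟩ := ENNReal.lt_iff_exists_nnreal_btwn.1 hε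
    exact ⟨q, by exact_mod_cast hq, by simpa using hqε.le⟩
  filter_upwards [hlim (ε' / 4) (by positivity), Filter.eventually_gt_atTop 0] with n hn hn0
  refine le_trans ?_ hle
  have hn1 : (1 : ℝ) ≤ (n : ℝ) ^ r := one_le_pow₀ (by exact_mod_cast hn0)
  have happ := approxMax_eq_of_forall_ne_zero fun v => (hn v).1
  set u : Set.range (componentIndex f) → Space r := fun v => (n : ℝ) ^ r • slope v.1 with hu
  set b : Set.range (componentIndex f) → ℝ := fun v =>
    Real.log ‖(cyclicResultant n f).coeff (n ^ r • v.1)‖ with hb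
  -- Multiplication by `n ^ r` leaves the corner locus unchanged, gives both maxima the same slopes,
  -- and keeps these at distance at least 1 from each other.
  have hron : maxAffine (fun v => (n : ℝ) ^ r * α v) u = fun x => (n : ℝ) ^ r * ronkinMax f x := by
    funext x
    rw [hα, maxAffine, maxAffine, Real.mul_iSup_of_nonneg (by positivity)]
    refine iSup_congr fun v => ?_
    rw [hu, inner_smul_left, conj_trivial, mul_add]
  have hsep : ∀ v v', u v ≠ u v' → 1 ≤ ‖u v - u v'‖ := fun v v' h =>
    one_le_norm_smul_slope_sub hn1 h
  have hS (x : Space r) : x ∈ spine f ↔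
      ¬ DifferentiableAt ℝ (maxAffine (fun v => (n : ℝ) ^ r * α v) u) x := by
    rw [hron, spine, Set.mem_ofPred_eq, not_iff_not]
    refine ⟨fun h => h.const_mul _, fun h => ?_⟩
    have := h.const_mul ((n : ℝ) ^ r)⁻¹
    simpa [inv_mul_cancel_left₀ (by positivity : (n : ℝ) ^ r ≠ 0)] using this
  have hA (x : Space r) : x ∈ approxSpine f n ↔ ¬ DifferentiableAt ℝ (maxAffine b u) x := by
    rw [approxSpine, Set.mem_ofPred_eq, happ, contDiffAt_maxAffine_iff (by simp)]
  refine Metric.hausdorffEDist_le_of_mem_edist (fun x hx => ?_) fun x hx => ?_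
  · obtain ⟨y, hy, hy'⟩ := exists_not_differentiableAt (b := fun v => (n : ℝ) ^ r * α v)
      (by linarith : 2 * (ε' / 4) < ε') (fun v => (hn v).2) hsep ((hA x).1 hx)
    refine ⟨y, (hS y).2 hy', ?_⟩
    rw [edist_dist, dist_comm]
    exact ENNReal.ofReal_le_ofReal (Metric.mem_ball.1 hy).le
  · obtain ⟨y, hy, hy'⟩ := exists_not_differentiableAt (b := b)
      (by linarith : 2 * (ε' / 4) < ε') (fun v => (abs_sub_comm _ _).trans_le (hn v).2) hsep
      ((hS x).1 hx)
    refine ⟨y, (hA y).2 hy', ?_⟩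
    rw [edist_dist, dist_comm]
    exact ENNReal.ofReal_le_ofReal (Metric.mem_ball.1 hy).le

end Amoeba

end

theorem mainTheorem7 (r : ℕ) (f : Amoeba.Laurent r) (hf : f ≠ 0) :
    (∀ n : ℕ, 0 < n →
      Amoeba.approxSpine f n ⊆ Amoeba.lopsidedAmoeba (Amoeba.cyclicResultant n f)) ∧
    Filter.Tendsto
      (fun n : ℕ => Metric.hausdorffEDist (Amoeba.approxSpine f n) (Amoeba.spine f))
      Filter.atTop (nhds 0) :=
  ⟨fun _ hn => Amoeba.approxSpine_subset_lopsidedAmoeba f hn,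
    Amoeba.tendsto_hausdorffEDist_approxSpine f⟩
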